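/- Let $n\ge 2$, $\alpha\in(0,1)$ and $r\in(0,1)$. Let $F$ be the distribution function of a law on $[0,1]$ with a density and full support $[0,1]$, such that $F^{n-1}$ is (weakly) convex on $[0,1]$. For laws on $[0,1]$, write $\mathrm{MPC}(F)$ for the set of mean-preserving contractions of $F$: the laws $G$ with the same mean as $F$ and $\int_0^z (F(v)-G(v))\,dv\ge 0$ for all $z\in[0,1]$ (a law is identified with its distribution function, and $G(v^-)=G([0,v))$). Consider the disclosure game with exogenous reservation value $r$: each of $n$ firms chooses the law of its posterior mean in $\mathrm{MPC}(F)$. A fraction $\alpha$ of consumers (inexperienced) visit firms in uniformly random order, stop at the first posterior mean $v\ge r$, and otherwise visit all firms and buy the best product; the others (savvy) visit all firms and buy the best product. Ties are broken uniformly. If all rivals use $G$, an inexperienced consumer visits a given firm with probability $\eta=\frac1n\sum_{k=0}^{n-1}G(r^-)^k$, the firm's belief that a visitor is inexperienced is $\widetilde\alpha=\frac{\alpha\eta}{\alpha\eta+1-\alpha}$, and the sale probability of a visited firm whose posterior mean is $v$ is $$u_G(v)=\begin{cases}\left(\frac{\widetilde\alpha}{\eta}+1-\widetilde\alpha\right)W_G(v),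 & v<r,\\ \widetilde\alpha+(1-\widetilde\alpha)W_G(v), & v\ge r,\end{cases}$$ where $$W_G(v)=\sum_{k=0}^{n-1}\binom{n-1}{k}\frac{G(\{v\})^k\,G(v^-)^{n-1-k}}{k+1}$$ is the probability of being chosen against $n-1$ independent draws from $G$; thus $W_G(v)=G(v)^{n-1}$ if $G$ has no atom at $v$. A symmetric equilibrium is a law $G\in\mathrm{MPC}(F)$ with $\int u_G\,dG\ge\int u_G\,d\widehat G$ for all $\widehat G\in\mathrm{MPC}(F)$. If $G$ is a symmetric equilibrium, then there are $\beta>0$, $v_L\in[0,r)$ and $v_H\in(r,1]$ such that (i) $G\in\mathrm{MPC}(F)$, (ii) $G(v_H)=F(v_H)$, and (iii) for all $v\in[0,1]$, $$G(v)=\begin{cases}F(v), & v\le v_L,\\ F(v_L), & v\in(v_L,r),\\ \min\left\{F(v_L)^{n-1}+\beta(v-r),\,1\right\}^{\frac1{n-1}}, & v\in[r,v_H],\\ F(v), & v\in(v_H,1].\end{cases}$$ -/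

import Mathlib

open MeasureTheory ProbabilityTheory Set

noncomputable section

/-- The common prior of the products' valuations: a law on `[0, 1]` that has a density with respect
to Lebesgue measure (in particular it is atomless) and full support `[0, 1]`. -/
structure IsPrior (F : Measure ℝ) : Prop where
  isProbabilityMeasure : IsProbabilityMeasure F
  absolutelyContinuous : F ≪ volume
  support_eq : F.support = Icc 0 1

/-- `IsMPC F G`: the law `G` on `[0, 1]` is a mean-preserving contraction of `F`, that is, the two
laws have the same mean and `∫₀ᶻ (F(v) - G(v)) dv ≥ 0` for all `z ∈ [0, 1]`. -/
structure IsMPC (F G : Measure ℝ) : Prop where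
  isProbabilityMeasure : IsProbabilityMeasure G
  concentrated : G (Icc 0 1)ᶜ = 0
  mean_eq : ∫ v, v ∂G = ∫ v, v ∂F
  integral_cdf_le : ∀ z ∈ Icc (0 : ℝ) 1, ∫ v in (0 : ℝ)..z, cdf G v ≤ ∫ v in (0 : ℝ)..z, cdf F v

/-- The probability that a product with posterior mean `v` is chosen by a consumer who compares it
with `n - 1` rivals whose posterior means are independent draws from `G`, when ties at the top are
broken uniformly: `k` rivals tie with `v`, the others are below `v`, and the product is picked with
probability `1 / (k + 1)`. If `G` has no atom at `v`, only the term `k = 0` survives and the value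
is `G(v) ^ (n - 1)`. -/
def winProb (n : ℕ) (G : Measure ℝ) (v : ℝ) : ℝ :=
  ∑ k ∈ Finset.range n,
    ((n - 1).choose k : ℝ) * G.real {v} ^ k * G.real (Iio v) ^ (n - 1 - k) / ((k : ℝ) + 1)

/-- The probability `η` that an inexperienced consumer visits a given firm. The order of search is
uniformly random, and the firm in position `k + 1` is visited if and only if the `k` firms before it
all had posterior means below the reservation value `r`. -/
def visitProb (n : ℕ) (r : ℝ) (G : Measure ℝ) : ℝ :=
  1 / (n : ℝ) * ∑ k ∈ Finset.range n, G.real (Iio r) ^ k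

/-- The probability that a visiting consumer is inexperienced, by Bayes' rule; `α` is the fraction
of inexperienced consumers, and the savvy ones visit every firm. -/
def visitBelief (n : ℕ) (α r : ℝ) (G : Measure ℝ) : ℝ :=
  α * visitProb n r G / (α * visitProb n r G + (1 - α))

/-- The probability of a sale for a firm that has been visited and whose realized posterior mean is
`v`, when all rivals use `G`. -/
def payoff (n : ℕ) (α r : ℝ) (G : Measure ℝ) (v : ℝ) : ℝ :=
  if v < r then
    (visitBelief n α r G / visitProb n r G + (1 - visitBelief n α r G)) * winProb n G v
  else
    visitBelief n α r G + (1 - visitBelief n α r G) * winProb n G v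

/-- `G` is a symmetric equilibrium of the disclosure game with `n` firms, prior `F`, fraction `α` of
inexperienced consumers and exogenous reservation value `r`: it is a feasible law of the posterior
mean, and it is a best response, among all feasible laws, when all rivals use `G`. -/
structure IsSymmetricEquilibrium (n : ℕ) (α r : ℝ) (F G : Measure ℝ) : Prop where
  feasible : IsMPC F G
  optimal : ∀ G' : Measure ℝ, IsMPC F G' →
    ∫ v, payoff n α r G v ∂G' ≤ ∫ v, payoff n α r G v ∂G

/-- The distribution function with parameters `β`, `vL`, `vH`: full disclosure up to `vL`, a gap on
`(vL, r)`, an `(n - 1)`-st power that is affine with slope `β` and capped at `1` on `[r, vH]`, and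
the prior above `vH`. -/
def disclosureCDF (n : ℕ) (r : ℝ) (F : Measure ℝ) (β vL vH v : ℝ) : ℝ :=
  if v ≤ vL then cdf F v
  else if v < r then cdf F vL
  else if v ≤ vH then
    (min (cdf F vL ^ (n - 1) + β * (v - r)) 1) ^ (1 / ((n : ℝ) - 1))
  else cdf F v

end

/-!
Write `D(z) = ∫₀ᶻ (F - G)` for the slack of the contraction constraint, and multiply the payoff by
the probability of a visit: against an atomless `G` it becomes `U = G ^ (n - 1)` below `r` and
`U = α η + (1 - α) G ^ (n - 1)` from `r` on, with an upward jump at `r` (`saleProb`).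

Two kinds of deviation carry the proof. Where `D > 0`, a little mass can be spread to two points on
either side, so `U` lies above its chords at support points of `G`
(`IsOptimal.chord_le_of_mem_support`). Pooling mass from near two points is always feasible, so `U`
lies below its chords between support points (`IsOptimal.le_chord_of_mem_support`). Spreading rules
out atoms, because ties make the payoff jump up just above an atom. Together, the two deviations
show that on every maximal interval `(c, e)` of `{D > 0}` the payoff lies below an increasing line and
touches it on the support (`IsOptimal.exists_isSupportLine`). Since `U` is constant across gaps of
the support, a gap cannot end at a support point, unless `r` lies in it.

If `r ∉ (c, e)`, then `U` is affine in `G ^ (n - 1)` on `(c, e)`, and comparison with the convex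
function `F ^ (n - 1)`, which agrees with `G ^ (n - 1)` at `c` and `e`, gives `F ≤ G` there and
contradicts `D > 0` (`IsOptimal.not_slack_of_affine`). So `D` vanishes, and `F = G`, outside a
single interval `(vL, vH)` around `r`.

The support does not meet `(vL, r)` (`IsSymmetricEquilibrium.notMem_support_of_mem_Ioo`). Local
deviations do not suffice for this; the reason is an accounting identity. If the support met
`(vL, r)`, then `G ^ (n - 1)` would start at `vL` along the support line `ℓ`, and convexity would
put `F ^ (n - 1)` strictly above `ℓ` on `(vL, vH)`. As `ℓ` has the same integral against `F` and
`G`, and `U ≤ F ^ (n - 1)` above `vH`, this gives `∫ U dG < ∫ F ^ (n - 1) dF`. But both sides are `1 / n`, by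
symmetry between the firms (`integral_saleProb`, `integral_cdf_pow`).

Hence `G` is constant on `[vL, r]`, and on `[r, vH]` it follows the support line, of slope
`(1 - α) β`, until the support ends. The support can only end before `vH` if `G` has reached `1`.
-/

open scoped Topology

/-! ### Distribution functions -/

theorem continuous_cdf_of_noAtoms (μ : Measure ℝ) [IsProbabilityMeasure μ] [NullSingletonClass μ] :
    Continuous (cdf μ) := by
  rw [continuous_iff_continuousAt]
  intro x
  rw [(cdf μ).mono.continuousAt_iff_leftLim_eq_rightLim, StieltjesFunction.rightLim_eq]
  have h : (cdf μ).measure {x} = 0 := by rw [measure_cdf]; exact measure_singleton x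
  rw [StieltjesFunction.measure_singleton, ENNReal.ofReal_eq_zero] at h
  exact le_antisymm ((cdf μ).mono.leftLim_le le_rfl) (by linarith)

theorem measureReal_Ioo_eq_cdf_sub (μ : Measure ℝ) [IsProbabilityMeasure μ] [NullSingletonClass μ]
    {a b : ℝ} (hab : a ≤ b) : μ.real (Ioo a b) = cdf μ b - cdf μ a := by
  rw [measureReal_congr (Ioo_ae_eq_Ioc (μ := μ)),
    show Ioc a b = Iic b \ Iic a by ext; simp [and_comm],
    measureReal_sdiff (Iic_subset_Iic.2 hab) measurableSet_Iic, cdf_eq_real, cdf_eq_real]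

theorem exists_mem_support_of_cdf_lt (μ : Measure ℝ) [IsProbabilityMeasure μ] [NullSingletonClass μ]
    {a b : ℝ} (h : cdf μ a < cdf μ b) : ∃ y ∈ μ.support, a < y ∧ y < b := by
  have hab : a ≤ b := by
    by_contra! hba
    exact absurd (monotone_cdf μ hba.le) (by linarith)
  have : 0 < μ.real (Ioo a b) := by rw [measureReal_Ioo_eq_cdf_sub μ hab]; linarith
  have h0 : 0 < μ (Ioo a b) := by
    rw [measureReal_def, ENNReal.toReal_pos_iff] at this
    exact this.1
  obtain ⟨y, hy, hys⟩ := Measure.nonempty_inter_support_of_pos h0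
  exact ⟨y, hys, hy.1, hy.2⟩

/-- The integrated distribution function is the expected value of the positive part `(z - v)⁺`;
this turns the integral constraints of `IsMPC` into linear functionals of the law. -/
theorem integral_cdf_eq (μ : Measure ℝ) [IsProbabilityMeasure μ] (hμ : μ (Icc 0 1)ᶜ = 0)
    {z : ℝ} (hz : 0 ≤ z) : ∫ t in (0 : ℝ)..z, cdf μ t = ∫ v, max (z - v) 0 ∂μ := by
  have h1 : ∀ t, cdf μ t = ∫ v, (Iic t).indicator (fun _ => (1 : ℝ)) v ∂μ := by
    intro t
    rw [integral_indicator measurableSet_Iic]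
    simp [cdf_eq_real]
  rw [intervalIntegral.integral_of_le hz]
  simp_rw [h1]
  rw [integral_integral_swap]
  · refine integral_congr_ae ?_
    have : ∀ᵐ v ∂μ, v ∈ Icc (0 : ℝ) 1 := by
      rw [ae_iff]; exact hμ
    filter_upwards [this] with v hv
    have h2 : (fun t => (Iic t).indicator (fun _ => (1 : ℝ)) v)
        = (Ici v).indicator (fun _ => (1 : ℝ)) := by
      ext t; simp [indicator]
    rw [h2, integral_indicator measurableSet_Ici]
    rw [Measure.restrict_restrict measurableSet_Ici]
    rw [integral_const, smul_eq_mul, mul_one, measureReal_restrict_apply_univ]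
    rcases eq_or_lt_of_le hv.1 with h0 | h0
    · have : Ici v ∩ Ioc 0 z = Ioc 0 z := by
        ext t; simp [← h0]; intro h _; exact h.le
      rw [this]; simp [← h0, hz]
    · have : Ici v ∩ Ioc 0 z = Icc v z := by
        ext t
        exact ⟨fun h => ⟨h.1, h.2.2⟩, fun h => ⟨h.1, h0.trans_le h.1, h.2⟩⟩
      rw [this]; simp
  · apply Integrable.mono' (g := fun _ => (1 : ℝ))
    · exact integrable_const _
    · apply Measurable.aestronglyMeasurable
      have : (Function.uncurry fun t v : ℝ => (Iic t).indicator (fun _ => (1 : ℝ)) v)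
          = {p : ℝ × ℝ | p.2 ≤ p.1}.indicator (fun _ => 1) := by
        ext ⟨t, v⟩; simp [indicator]
      rw [this]
      exact measurable_const.indicator (measurableSet_le measurable_snd measurable_fst)
    · refine .of_forall ?_
      rintro ⟨t, v⟩
      simp only [Function.uncurry, indicator]
      split_ifs <;> simp

/-! ### Optimal laws and feasible perturbations -/

/-- The slack `∫₀ᶻ (F - G)` of the contraction constraint at `z`. -/
noncomputable def slack (F G : Measure ℝ) (z : ℝ) : ℝ :=
  (∫ v in (0 : ℝ)..z, cdf F v) - ∫ v in (0 : ℝ)..z, cdf G v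

/-- `G` is a mean-preserving contraction of `F` that maximizes the expectation of `u`. -/
structure IsOptimal (F G : Measure ℝ) (u : ℝ → ℝ) : Prop where
  feasible : IsMPC F G
  optimal : ∀ G' : Measure ℝ, IsMPC F G' → ∫ v, u v ∂G' ≤ ∫ v, u v ∂G

theorem integrable_of_bounded {μ : Measure ℝ} [IsFiniteMeasure μ] {u : ℝ → ℝ} (hu : Measurable u)
    {C : ℝ} (hC : ∀ v, |u v| ≤ C) : Integrable u μ :=
  Integrable.mono' (integrable_const C) hu.aestronglyMeasurable (.of_forall hC)

theorem integrable_of_continuous_of_compl_Icc {μ : Measure ℝ} [IsFiniteMeasure μ]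
    (hμ : μ (Icc 0 1)ᶜ = 0) {f : ℝ → ℝ} (hf : Continuous f) : Integrable f μ := by
  have h : μ.restrict (Icc 0 1) = μ := Measure.restrict_eq_self_of_ae_mem (by
    rw [ae_iff]; exact hμ)
  rw [← h]
  exact hf.continuousOn.integrableOn_compact isCompact_Icc

/-- Replacing a part `ν` of an optimal law by a measure `ρ` with the same mass and mean does not
raise the payoff, provided that the increase of `∫ (z - v)⁺` is covered by the slack. -/
theorem IsOptimal.integral_le_of_swap {F G : Measure ℝ} {u : ℝ → ℝ} (h : IsOptimal F G u)
    (hu : Measurable u) {C : ℝ} (hC : ∀ v, |u v| ≤ C) {ν ρ : Measure ℝ} [IsFiniteMeasure ρ]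
    (hν : ν ≤ G) (hρ : ρ (Icc 0 1)ᶜ = 0) (hmass : ρ univ = ν univ)
    (hmean : ∫ v, v ∂ρ = ∫ v, v ∂ν)
    (hslack : ∀ z ∈ Icc (0 : ℝ) 1,
      ∫ v, max (z - v) 0 ∂ρ - ∫ v, max (z - v) 0 ∂ν ≤ slack F G z) :
    ∫ v, u v ∂ρ ≤ ∫ v, u v ∂ν := by
  have hGp := h.feasible.isProbabilityMeasure
  have hνf : IsFiniteMeasure ν := isFiniteMeasure_of_le G hν
  have hν0 : ν (Icc 0 1)ᶜ = 0 := le_antisymm ((hν _).trans h.feasible.concentrated.le) bot_le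
  have hsub : G - ν + ν = G := Measure.sub_add_cancel_of_le hν
  have hκG : G - ν ≤ G := Measure.sub_le
  have hκf : IsFiniteMeasure (G - ν) := isFiniteMeasure_of_le G hκG
  have hκ0 : (G - ν) (Icc 0 1)ᶜ = 0 :=
    le_antisymm ((hκG _).trans h.feasible.concentrated.le) bot_le
  have key : ∀ f : ℝ → ℝ, Integrable f (G - ν) → Integrable f ν → Integrable f ρ →
      ∫ v, f v ∂(G - ν + ρ) = ∫ v, f v ∂G - ∫ v, f v ∂ν + ∫ v, f v ∂ρ := by
    intro f h1 h2 h3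
    rw [integral_add_measure h1 h3]
    have : ∫ v, f v ∂G = ∫ v, f v ∂(G - ν + ν) := by rw [hsub]
    rw [this, integral_add_measure h1 h2]
    ring
  have keyc : ∀ f : ℝ → ℝ, Continuous f →
      ∫ v, f v ∂(G - ν + ρ) = ∫ v, f v ∂G - ∫ v, f v ∂ν + ∫ v, f v ∂ρ := fun f hf =>
    key f (integrable_of_continuous_of_compl_Icc hκ0 hf)
      (integrable_of_continuous_of_compl_Icc hν0 hf) (integrable_of_continuous_of_compl_Icc hρ hf)
  have hprob : IsProbabilityMeasure (G - ν + ρ) := by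
    constructor
    rw [Measure.add_apply, hmass, ← Measure.add_apply, hsub, measure_univ]
  have hconc : (G - ν + ρ) (Icc 0 1)ᶜ = 0 := by rw [Measure.add_apply, hκ0, hρ, add_zero]
  have hfeas : IsMPC F (G - ν + ρ) := by
    refine ⟨hprob, hconc, ?_, ?_⟩
    · rw [keyc _ continuous_id', hmean, h.feasible.mean_eq]; ring
    · intro z hz
      rw [integral_cdf_eq _ hconc hz.1, keyc _ (by fun_prop)]
      have h1 := hslack z hz
      rw [slack, integral_cdf_eq G h.feasible.concentrated hz.1] at h1
      linarith
  have := h.optimal _ hfeas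
  rw [key u (integrable_of_bounded hu hC) (integrable_of_bounded hu hC)
    (integrable_of_bounded hu hC)] at this
  linarith

theorem continuous_slack (F G : Measure ℝ) : Continuous (slack F G) := by
  unfold slack
  have h : ∀ μ : Measure ℝ, Continuous fun z => ∫ v in (0 : ℝ)..z, cdf μ v := fun μ =>
    intervalIntegral.continuous_primitive
      (fun a b => (monotone_cdf μ).intervalIntegrable) 0
  exact (h F).sub (h G)

theorem setIntegral_pos_of_pos {μ : Measure ℝ} {A : Set ℝ} (hA : MeasurableSet A) (hμA : 0 < μ A)
    {f : ℝ → ℝ} (hf : ∀ v ∈ A, 0 < f v) (hfi : IntegrableOn f A μ) : 0 < ∫ v in A, f v ∂μ := by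
  rw [setIntegral_pos_iff_support_of_nonneg_ae _ hfi]
  · have : Function.support f ∩ A = A := inter_eq_right.2 fun v hv => (hf v hv).ne'
    rwa [this]
  · exact (ae_restrict_mem hA).mono fun v hv => (hf v hv).le

theorem ae_restrict_mem_Icc {G : Measure ℝ} (hG : G (Icc 0 1)ᶜ = 0) (A : Set ℝ) :
    ∀ᵐ v ∂(G.restrict A), v ∈ Icc (0 : ℝ) 1 :=
  ae_restrict_of_ae (by rw [ae_iff]; exact hG)

theorem support_subset_Icc {G : Measure ℝ} (hG : G (Icc 0 1)ᶜ = 0) :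
    G.support ⊆ Icc 0 1 :=
  Measure.support_subset_of_isClosed isClosed_Icc (mem_ae_iff.2 hG)

/-- Where the constraint is slack on `[x, z]`, mass inside `[x, z]` can be spread to the endpoints;
optimality makes this unprofitable. -/
theorem IsOptimal.setIntegral_chord_le {F G : Measure ℝ} {u : ℝ → ℝ} (h : IsOptimal F G u)
    (hu : Measurable u) {C : ℝ} (hC : ∀ v, |u v| ≤ C) {x z : ℝ} (hx : 0 ≤ x) (hxz : x < z)
    (hz : z ≤ 1) (hpos : ∀ w ∈ Icc x z, 0 < slack F G w) {A : Set ℝ} (hA : MeasurableSet A)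
    (hAs : A ⊆ Icc x z) :
    ∫ v in A, ((z - v) * u x + (v - x) * u z - (z - x) * u v) ∂G ≤ 0 := by
  have hGp := h.feasible.isProbabilityMeasure
  obtain ⟨w₀, hw₀, hmin⟩ := isCompact_Icc.exists_isMinOn (nonempty_Icc.2 hxz.le)
    (continuous_slack F G).continuousOn
  set ε := min 1 (slack F G w₀) with hε
  have hε0 : 0 < ε := lt_min one_pos (hpos _ hw₀)
  have hε1 : ε ≤ 1 := min_le_left _ _
  have hint : ∀ f : ℝ → ℝ, Continuous f → IntegrableOn f A G := fun f hf =>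
    (integrable_of_continuous_of_compl_Icc h.feasible.concentrated hf).integrableOn
  set p := ∫ v in A, (z - v) ∂G with hp
  set q := ∫ v in A, (v - x) ∂G with hq
  have hp0 : 0 ≤ p := setIntegral_nonneg hA fun v hv => by linarith [(hAs hv).2]
  have hq0 : 0 ≤ q := setIntegral_nonneg hA fun v hv => by linarith [(hAs hv).1]
  have hpq : p + q = (z - x) * G.real A := by
    rw [hp, hq, ← integral_add (hint _ (by fun_prop)) (hint _ (by fun_prop))]
    simp [mul_comm]
  set ν : Measure ℝ := ENNReal.ofReal (ε * (z - x)) • G.restrict A with hν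
  set ρ : Measure ℝ := ENNReal.ofReal (ε * p) • Measure.dirac x
    + ENNReal.ofReal (ε * q) • Measure.dirac z with hρ
  have hzx : 0 < z - x := sub_pos.2 hxz
  have hνi : ∀ f : ℝ → ℝ, ∫ v, f v ∂ν = ε * ((z - x) * ∫ v in A, f v ∂G) := fun f => by
    rw [hν, integral_smul_measure, ENNReal.toReal_ofReal (by positivity), smul_eq_mul, mul_assoc]
  have hρf : IsFiniteMeasure ρ := by
    rw [hρ]
    exact ⟨by simp [ENNReal.add_lt_top]⟩
  have hρi : ∀ f : ℝ → ℝ, ∫ v, f v ∂ρ = ε * (p * f x + q * f z) := fun f => by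
    have hd : ∀ (c : ℝ) (a : ℝ), Integrable f (ENNReal.ofReal c • Measure.dirac a) := fun c a =>
      (integrable_dirac (by simp)).smul_measure ENNReal.ofReal_ne_top
    rw [hρ, integral_add_measure (hd _ _) (hd _ _), integral_smul_measure, integral_smul_measure,
      integral_dirac, integral_dirac, ENNReal.toReal_ofReal (by positivity),
      ENNReal.toReal_ofReal (by positivity), smul_eq_mul, smul_eq_mul]
    ring
  have hdiff : ∀ f : ℝ → ℝ, IntegrableOn f A G → ∫ v, f v ∂ρ - ∫ v, f v ∂ν
      = ε * ∫ v in A, ((z - v) * f x + (v - x) * f z - (z - x) * f v) ∂G := fun f hf => by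
    have h1 : IntegrableOn (fun v => (z - v) * f x) A G := hint _ (by fun_prop)
    have h2 : IntegrableOn (fun v => (v - x) * f z) A G := hint _ (by fun_prop)
    have h12 : IntegrableOn (fun v => (z - v) * f x + (v - x) * f z) A G := h1.add h2
    have h3 : IntegrableOn (fun v => (z - x) * f v) A G := hf.const_mul _
    rw [hρi, hνi, integral_sub h12 h3, integral_add h1 h2, integral_mul_const,
      integral_mul_const, integral_const_mul]
    ring
  have hle : ν ≤ G := by
    rw [hν]
    calc _ ≤ (1 : ENNReal) • G.restrict A := by
          gcongr
          rw [ENNReal.ofReal_le_one]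
          nlinarith
      _ ≤ G := by rw [one_smul]; exact Measure.restrict_le_self
  have hmass : ρ univ = ν univ := by
    simp only [hρ, hν, Measure.add_apply, Measure.smul_apply, measure_univ, smul_eq_mul, mul_one,
      Measure.restrict_apply_univ]
    rw [← ENNReal.ofReal_add (by positivity) (by positivity), ← mul_add, hpq,
      ← ofReal_measureReal (μ := G) (s := A), ← ENNReal.ofReal_mul (by positivity), mul_assoc]
  have hconc : ρ (Icc 0 1)ᶜ = 0 := by
    simp only [hρ, Measure.add_apply, Measure.smul_apply, smul_eq_mul]
    rw [Measure.dirac_apply' _ measurableSet_Icc.compl,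
      Measure.dirac_apply' _ measurableSet_Icc.compl, indicator_of_notMem, indicator_of_notMem]
    · simp
    · simp only [mem_compl_iff, not_not]; exact ⟨by linarith, hz⟩
    · simp only [mem_compl_iff, not_not]; exact ⟨hx, by linarith⟩
  have := h.integral_le_of_swap hu hC hle hconc hmass ?_ ?_
  · have h1 := hdiff u (integrable_of_bounded hu hC).integrableOn
    by_contra! hcon
    have := mul_pos hε0 hcon
    linarith
  · rw [← sub_eq_zero, hdiff _ (hint _ continuous_id')]
    have : ∀ v : ℝ, (z - v) * x + (v - x) * z - (z - x) * v = 0 := fun v => by ring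
    simp [this]
  · intro w hw
    rw [hdiff _ (hint _ (by fun_prop))]
    have hsl : 0 ≤ slack F G w := sub_nonneg.2 (h.feasible.integral_cdf_le w hw)
    by_cases hwi : w ∈ Icc x z
    · have h1 : ∫ v in A, ((z - v) * max (w - x) 0 + (v - x) * max (w - z) 0
          - (z - x) * max (w - v) 0) ∂G ≤ ∫ v in A, (1 : ℝ) ∂G := by
        refine setIntegral_mono_on (hint _ (by fun_prop)) (hint _ (by fun_prop)) hA fun v hv => ?_
        rw [max_eq_left (by linarith [hwi.1]), max_eq_right (by linarith [hwi.2])]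
        have h2 : 0 ≤ (z - x) * max (w - v) 0 := by positivity
        have h3 := hAs hv
        nlinarith [h3.1, h3.2, hwi.1, hwi.2]
      have h2 : ∫ v in A, (1 : ℝ) ∂G ≤ 1 := by simp
      calc _ ≤ ε * 1 := by gcongr; exact h1.trans h2
        _ ≤ slack F G w₀ := by rw [mul_one]; exact min_le_right _ _
        _ ≤ _ := hmin hwi
    · have h1 : ∫ v in A, ((z - v) * max (w - x) 0 + (v - x) * max (w - z) 0
          - (z - x) * max (w - v) 0) ∂G ≤ 0 := by
        refine setIntegral_nonpos hA fun v hv => ?_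
        have h3 := hAs hv
        rcases lt_or_ge w x with hwx | hwx
        · rw [max_eq_right (by linarith), max_eq_right (by linarith)]
          have h2 : 0 ≤ (z - x) * max (w - v) 0 := by positivity
          linarith
        · have hwz : z < w := by
            by_contra! hc
            exact hwi ⟨hwx, hc⟩
          rw [max_eq_left (by linarith), max_eq_left (by linarith),
            max_eq_left (by linarith [h3.2])]
          exact le_of_eq (by ring)
      nlinarith

/-- At a support point inside a slack interval, the payoff lies above the chord. -/
theorem IsOptimal.chord_le_of_mem_support {F G : Measure ℝ} {u : ℝ → ℝ} (h : IsOptimal F G u)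
    (hu : Measurable u) {C : ℝ} (hC : ∀ v, |u v| ≤ C) (husc : UpperSemicontinuous u)
    {x y z : ℝ} (hx : 0 ≤ x) (hxy : x < y) (hyz : y < z) (hz : z ≤ 1)
    (hpos : ∀ w ∈ Icc x z, 0 < slack F G w) (hy : y ∈ G.support) :
    (z - y) * u x + (y - x) * u z ≤ (z - x) * u y := by
  have hGp := h.feasible.isProbabilityMeasure
  by_contra! hlt
  have hzx : 0 < z - x := by linarith
  have h1 : u y < ((z - y) * u x + (y - x) * u z) / (z - x) := by
    rw [lt_div_iff₀ hzx]; linarith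
  obtain ⟨c, hc1, hc2⟩ := exists_between h1
  have hcont : Continuous fun v => ((z - v) * u x + (v - x) * u z) / (z - x) := by fun_prop
  have hev : ∀ᶠ v in 𝓝 y, u v < c ∧ c < ((z - v) * u x + (v - x) * u z) / (z - x) ∧
      v ∈ Ioo x z :=
    (husc y c hc1).and ((hcont.continuousAt.eventually_const_lt hc2).and (Ioo_mem_nhds hxy hyz))
  obtain ⟨A, hAs, hAo, hyA⟩ := mem_nhds_iff.1 hev
  have hGA : 0 < G A := (Measure.mem_support_iff_forall y).1 hy A (hAo.mem_nhds hyA)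
  have hle := h.setIntegral_chord_le hu hC hx (hxy.trans hyz) hz hpos hAo.measurableSet
    fun v hv => Ioo_subset_Icc_self (hAs hv).2.2
  refine absurd hle (not_le.2 (setIntegral_pos_of_pos hAo.measurableSet hGA (fun v hv => ?_) ?_))
  · obtain ⟨ha, hb, -⟩ := hAs hv
    rw [lt_div_iff₀ hzx] at hb
    nlinarith
  · exact ((integrable_of_continuous_of_compl_Icc h.feasible.concentrated
      (by fun_prop)).sub ((integrable_of_bounded hu hC).const_mul _)).integrableOn

/-- Between two support points, the payoff lies below the chord: otherwise pooling mass from near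
the two points is profitable, and pooling is always feasible. -/
theorem IsOptimal.le_chord_of_mem_support {F G : Measure ℝ} {u : ℝ → ℝ} (h : IsOptimal F G u)
    (hu : Measurable u) {C : ℝ} (hC : ∀ v, |u v| ≤ C) (husc : UpperSemicontinuous u)
    {x y z : ℝ} (hxy : x < y) (hyz : y < z) (hx : x ∈ G.support) (hz : z ∈ G.support) :
    (z - x) * u y ≤ (z - y) * u x + (y - x) * u z := by
  have hGp := h.feasible.isProbabilityMeasure
  have hG0 := h.feasible.concentrated
  have hx01 := support_subset_Icc hG0 hx
  have hz01 := support_subset_Icc hG0 hz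
  by_contra! hlt
  -- A line through `(y, u y)` that passes strictly above `u` at `x` and at `z`.
  obtain ⟨m, hm1, hm2⟩ : ∃ m, (u z - u y) / (z - y) < m ∧ m < (u y - u x) / (y - x) := by
    apply exists_between
    rw [div_lt_div_iff₀ (by linarith) (by linarith)]
    nlinarith
  rw [div_lt_iff₀ (by linarith)] at hm1
  rw [lt_div_iff₀ (by linarith)] at hm2
  have hcont : Continuous fun v => u y + m * (v - y) := by fun_prop
  have nbhd : ∀ a, u a < u y + m * (a - y) → ∀ᶠ v in 𝓝 a, u v < u y + m * (v - y) := by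
    intro a ha
    obtain ⟨c, hc1, hc2⟩ := exists_between ha
    filter_upwards [husc a c hc1, hcont.continuousAt.eventually_const_lt hc2] with v h1 h2
    exact h1.trans h2
  obtain ⟨A, hAs, hAo, hxA⟩ := mem_nhds_iff.1
    ((nbhd x (by linarith)).and (Iio_mem_nhds hxy))
  obtain ⟨B, hBs, hBo, hzB⟩ := mem_nhds_iff.1
    ((nbhd z (by linarith)).and (Ioi_mem_nhds hyz))
  have hA := hAo.measurableSet
  have hB := hBo.measurableSet
  have hGA : 0 < G A := (Measure.mem_support_iff_forall x).1 hx A (hAo.mem_nhds hxA)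
  have hGB : 0 < G B := (Measure.mem_support_iff_forall z).1 hz B (hBo.mem_nhds hzB)
  have hint : ∀ f : ℝ → ℝ, Continuous f → Integrable f G := fun f hf =>
    integrable_of_continuous_of_compl_Icc hG0 hf
  have hui : Integrable u G := integrable_of_bounded hu hC
  -- The weights make the barycentre of the pooled mass exactly `y`.
  set s := ∫ v in B, (v - y) ∂G with hs
  set t := ∫ v in A, (y - v) ∂G with ht
  have hs0 : 0 < s := setIntegral_pos_of_pos hB hGB (fun v hv => sub_pos.2 (hBs hv).2)
    (hint _ (by fun_prop)).integrableOn
  have ht0 : 0 < t := setIntegral_pos_of_pos hA hGA (fun v hv => sub_pos.2 (hAs hv).2)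
    (hint _ (by fun_prop)).integrableOn
  have hle1 : ∀ (D : Set ℝ) (f : ℝ → ℝ), Continuous f → (∀ v ∈ Icc (0 : ℝ) 1, f v ≤ 1) →
      ∫ v in D, f v ∂G ≤ 1 := by
    intro D f hf hf1
    calc ∫ v in D, f v ∂G ≤ ∫ v in D, (1 : ℝ) ∂G := integral_mono_ae (hint _ hf).integrableOn
          (hint _ continuous_const).integrableOn
          ((ae_restrict_mem_Icc hG0 D).mono fun v hv => hf1 v hv)
      _ ≤ 1 := by simp
  have hs1 : s ≤ 1 := hle1 B _ (by fun_prop) fun v hv => by linarith [hv.2, hx01.1]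
  have ht1 : t ≤ 1 := hle1 A _ (by fun_prop) fun v hv => by linarith [hv.1, hz01.2]
  have hsB : s = ∫ v in B, v ∂G - y * G.real B := by
    rw [hs, integral_sub (hint _ continuous_id').integrableOn
      (hint _ continuous_const).integrableOn]
    simp [mul_comm]
  have htA : t = y * G.real A - ∫ v in A, v ∂G := by
    rw [ht, integral_sub (hint _ continuous_const).integrableOn
      (hint _ continuous_id').integrableOn]
    simp [mul_comm]
  set a := G.real A with ha
  set b := G.real B with hb
  have ha0 : 0 ≤ a := measureReal_nonneg
  have hb0 : 0 ≤ b := measureReal_nonneg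
  have hdisj : Disjoint A B := disjoint_left.2 fun v hvA hvB =>
    lt_asymm (hAs hvA).2 (hBs hvB).2
  set ν : Measure ℝ := ENNReal.ofReal s • G.restrict A + ENNReal.ofReal t • G.restrict B with hν
  set ρ : Measure ℝ := ENNReal.ofReal (s * a + t * b) • Measure.dirac y with hρ
  have hρf : IsFiniteMeasure ρ := by
    rw [hρ]
    exact ⟨by simp⟩
  have hνi : ∀ f : ℝ → ℝ, Integrable f G →
      ∫ v, f v ∂ν = s * ∫ v in A, f v ∂G + t * ∫ v in B, f v ∂G := fun f hf => by
    rw [hν, integral_add_measure (hf.integrableOn.smul_measure ENNReal.ofReal_ne_top)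
      (hf.integrableOn.smul_measure ENNReal.ofReal_ne_top), integral_smul_measure,
      integral_smul_measure, ENNReal.toReal_ofReal hs0.le, ENNReal.toReal_ofReal ht0.le,
      smul_eq_mul, smul_eq_mul]
  have hρi : ∀ f : ℝ → ℝ, ∫ v, f v ∂ρ = (s * a + t * b) * f y := fun f => by
    rw [hρ, integral_smul_measure, integral_dirac, ENNReal.toReal_ofReal (by positivity),
      smul_eq_mul]
  have hle : ν ≤ G := by
    rw [hν]
    calc _ ≤ (1 : ENNReal) • G.restrict A + (1 : ENNReal) • G.restrict B := by
          gcongr <;> rw [ENNReal.ofReal_le_one] <;> assumption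
      _ = G.restrict (A ∪ B) := by
          rw [one_smul, one_smul, Measure.restrict_union hdisj hB]
      _ ≤ G := Measure.restrict_le_self
  have hmass : ρ univ = ν univ := by
    simp only [hρ, hν, Measure.add_apply, Measure.smul_apply, measure_univ, smul_eq_mul, mul_one,
      Measure.restrict_apply_univ]
    rw [ENNReal.ofReal_add (by positivity) (by positivity), ENNReal.ofReal_mul hs0.le,
      ENNReal.ofReal_mul ht0.le, ha, hb, ofReal_measureReal, ofReal_measureReal]
  have hconc : ρ (Icc 0 1)ᶜ = 0 := by
    simp only [hρ, Measure.smul_apply, smul_eq_mul]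
    rw [Measure.dirac_apply' _ measurableSet_Icc.compl, indicator_of_notMem]
    · simp
    · simp only [mem_compl_iff, not_not]; exact ⟨by linarith [hx01.1], by linarith [hz01.2]⟩
  have hmean : ∫ v, v ∂ρ = ∫ v, v ∂ν := by
    rw [hρi, hνi _ (hint _ continuous_id')]
    have e1 : ∫ v in B, v ∂G = s + y * b := by linarith
    have e2 : ∫ v in A, v ∂G = y * a - t := by linarith
    rw [e1, e2]; ring
  -- The loss of `∫ f` from pooling is the integral of the deviation of `f` from any line through
  -- `(y, f y)`, because the barycentre is `y`.
  have hgain : ∀ (f : ℝ → ℝ) (σ : ℝ), Integrable f G →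
      s * ∫ v in A, (f v - f y - σ * (v - y)) ∂G + t * ∫ v in B, (f v - f y - σ * (v - y)) ∂G
        = ∫ v, f v ∂ν - ∫ v, f v ∂ρ := by
    intro f σ hf
    have hsplit : ∀ D : Set ℝ, ∫ v in D, (f v - f y - σ * (v - y)) ∂G
        = ∫ v in D, f v ∂G - G.real D * f y - σ * (∫ v in D, v ∂G - G.real D * y) := by
      intro D
      have h1 : IntegrableOn (fun v => f v - f y) D G :=
        (hf.sub (hint _ continuous_const)).integrableOn
      have h2 : IntegrableOn (fun v => σ * (v - y)) D G := (hint _ (by fun_prop)).integrableOn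
      rw [integral_sub h1 h2, integral_sub hf.integrableOn
        (hint _ continuous_const).integrableOn, integral_const_mul,
        integral_sub (hint _ continuous_id').integrableOn
        (hint _ continuous_const).integrableOn]
      simp
    have e1 : ∫ v in B, v ∂G = s + y * b := by linarith
    have e2 : ∫ v in A, v ∂G = y * a - t := by linarith
    rw [hsplit, hsplit, hνi f hf, hρi, e1, e2, ← ha, ← hb]
    ring
  have hfin := h.integral_le_of_swap hu hC hle hconc hmass hmean ?_
  · have h1 := hgain u m hui
    have hi : Integrable (fun v => u y + m * (v - y) - u v) G := (hint _ hcont).sub hui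
    have hA1 : 0 < ∫ v in A, (u y + m * (v - y) - u v) ∂G :=
      setIntegral_pos_of_pos hA hGA (fun v hv => sub_pos.2 (hAs hv).1) hi.integrableOn
    have hB1 : 0 < ∫ v in B, (u y + m * (v - y) - u v) ∂G :=
      setIntegral_pos_of_pos hB hGB (fun v hv => sub_pos.2 (hBs hv).1) hi.integrableOn
    have hneg : ∀ D : Set ℝ, ∫ v in D, (u v - u y - m * (v - y)) ∂G
        = -∫ v in D, (u y + m * (v - y) - u v) ∂G := fun D => by
      rw [← integral_neg]; congr 1; ext v; ring
    rw [hneg, hneg] at h1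
    have := mul_pos hs0 hA1
    have := mul_pos ht0 hB1
    linarith
  · intro w hw
    have hsl : 0 ≤ slack F G w := sub_nonneg.2 (h.feasible.integral_cdf_le w hw)
    -- `σ` is a subgradient of `(w - ·)⁺` at `y`.
    have h1 := hgain (fun v => max (w - v) 0) (if y < w then -1 else 0)
      (hint _ (by fun_prop))
    have hnn : ∀ D : Set ℝ, 0 ≤ ∫ v in D, (max (w - v) 0 - max (w - y) 0
        - (if y < w then -1 else 0) * (v - y)) ∂G := by
      intro D
      refine integral_nonneg fun v => ?_
      show (0 : ℝ) ≤ _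
      split_ifs with hyw
      · rw [max_eq_left (show (0 : ℝ) ≤ w - y by linarith)]
        linarith [le_max_left (w - v) 0]
      · rw [max_eq_right (show w - y ≤ (0 : ℝ) by linarith)]
        linarith [le_max_right (w - v) 0]
    have := mul_nonneg hs0.le (hnn A)
    have := mul_nonneg ht0.le (hnn B)
    linarith

/-! ### Slack of the contraction constraint -/

theorem slack_sub_slack (F G : Measure ℝ) (a b : ℝ) :
    slack F G b - slack F G a = ∫ t in a..b, (cdf F t - cdf G t) := by
  have hi : ∀ (μ : Measure ℝ) (a b : ℝ), IntervalIntegrable (cdf μ) volume a b := fun μ a b =>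
    (monotone_cdf μ).intervalIntegrable
  rw [intervalIntegral.integral_sub (hi F a b) (hi G a b), slack, slack,
    ← intervalIntegral.integral_interval_sub_left (hi F 0 b) (hi F 0 a),
    ← intervalIntegral.integral_interval_sub_left (hi G 0 b) (hi G 0 a)]
  ring

theorem slack_le_slack_of_cdf_le {F G : Measure ℝ} {a b : ℝ} (hab : a ≤ b)
    (h : ∀ t ∈ Ioo a b, cdf F t ≤ cdf G t) : slack F G b ≤ slack F G a := by
  have h0 : ∫ t in a..b, (cdf G t - cdf F t) = -∫ t in a..b, (cdf F t - cdf G t) := by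
    rw [← intervalIntegral.integral_neg]; simp
  have h1 : 0 ≤ ∫ t in a..b, (cdf G t - cdf F t) := by
    rw [intervalIntegral.integral_of_le hab, integral_Ioc_eq_integral_Ioo]
    exact setIntegral_nonneg measurableSet_Ioo fun t ht => sub_nonneg.2 (h t ht)
  have := slack_sub_slack F G a b
  linarith

theorem slack_lt_slack_of_cdf_lt {F G : Measure ℝ} {a b : ℝ} (hab : a < b)
    (h : ∀ t ∈ Ioo a b, cdf G t < cdf F t) : slack F G a < slack F G b := by
  have h1 : 0 < ∫ t in a..b, (cdf F t - cdf G t) :=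
    intervalIntegral.intervalIntegral_pos_of_pos_on
      ((monotone_cdf F).intervalIntegrable.sub (monotone_cdf G).intervalIntegrable)
      (fun t ht => sub_pos.2 (h t ht)) hab
  have := slack_sub_slack F G a b
  linarith

theorem slack_lt_slack_of_lt_cdf {F G : Measure ℝ} {a b : ℝ} (hab : a < b)
    (h : ∀ t ∈ Ioo a b, cdf F t < cdf G t) : slack F G b < slack F G a := by
  have h1 := slack_lt_slack_of_cdf_lt hab h
  unfold slack at h1 ⊢
  linarith

theorem slack_zero (F G : Measure ℝ) : slack F G 0 = 0 := by simp [slack]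

theorem IsMPC.slack_nonneg {F G : Measure ℝ} (h : IsMPC F G) {z : ℝ} (hz : z ∈ Icc (0 : ℝ) 1) :
    0 ≤ slack F G z :=
  sub_nonneg.2 (h.integral_cdf_le z hz)

theorem cdf_zero_of_measure_singleton {μ : Measure ℝ} [IsProbabilityMeasure μ]
    (h : μ (Icc 0 1)ᶜ = 0)
    (h0 : μ {0} = 0) : cdf μ 0 = 0 := by
  rw [cdf_eq_real, measureReal_eq_zero_iff]
  refine measure_mono_null (t := (Icc 0 1)ᶜ ∪ {0}) (fun v hv => ?_) (measure_union_null h h0)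
  rcases eq_or_lt_of_le (mem_Iic.1 hv) with h1 | h1
  · exact .inr h1
  · exact .inl fun h2 => absurd h2.1 (not_le.2 h1)

theorem cdf_one {μ : Measure ℝ} [IsProbabilityMeasure μ] (h : μ (Icc 0 1)ᶜ = 0) :
    cdf μ 1 = 1 := by
  have h1 : μ (Iic 1)ᶜ = 0 := 
    measure_mono_null (compl_subset_compl.2 fun v hv => hv.2) h
  rw [cdf_eq_real, measureReal_def, (prob_compl_eq_zero_iff measurableSet_Iic).1 h1,
    ENNReal.toReal_one]

namespace IsPrior

variable {F : Measure ℝ} (hF : IsPrior F)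
include hF

theorem concentrated : F (Icc 0 1)ᶜ = 0 := by
  rw [← hF.support_eq]
  exact Measure.measure_compl_support

theorem nullSingletonClass : NullSingletonClass F :=
  ⟨fun x => hF.absolutelyContinuous (measure_singleton x)⟩

theorem cdf_zero : cdf F 0 = 0 :=
  haveI := hF.isProbabilityMeasure
  cdf_zero_of_measure_singleton hF.concentrated (hF.absolutelyContinuous (measure_singleton 0))

theorem cdf_one : cdf F 1 = 1 :=
  haveI := hF.isProbabilityMeasure
  _root_.cdf_one hF.concentrated

theorem continuous_cdf : Continuous (cdf F) :=
  haveI := hF.isProbabilityMeasure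
  haveI := hF.nullSingletonClass
  continuous_cdf_of_noAtoms F

theorem cdf_lt_cdf {a b : ℝ} (ha : 0 ≤ a) (hab : a < b) (hb : b ≤ 1) : cdf F a < cdf F b := by
  have := hF.isProbabilityMeasure
  have := hF.nullSingletonClass
  have hm : (a + b) / 2 ∈ F.support := by
    rw [hF.support_eq]; constructor <;> linarith
  have h := (Measure.mem_support_iff_forall _).1 hm (Ioo a b)
    (Ioo_mem_nhds (by linarith) (by linarith))
  have h2 : 0 < F.real (Ioo a b) := ENNReal.toReal_pos h.ne' (measure_ne_top _ _)
  rw [measureReal_Ioo_eq_cdf_sub F hab.le] at h2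
  linarith

end IsPrior

theorem IsMPC.slack_one {F G : Measure ℝ} (hF : IsPrior F) (h : IsMPC F G) :
    slack F G 1 = 0 := by
  have := hF.isProbabilityMeasure
  have := h.isProbabilityMeasure
  have key : ∀ μ : Measure ℝ, IsProbabilityMeasure μ → μ (Icc 0 1)ᶜ = 0 →
      ∫ t in (0 : ℝ)..1, cdf μ t = 1 - ∫ v, v ∂μ := by
    intro μ _ hμ
    rw [integral_cdf_eq μ hμ zero_le_one]
    have hae : ∀ᵐ v ∂μ, v ∈ Icc (0 : ℝ) 1 := by rw [ae_iff]; exact hμ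
    rw [integral_congr_ae (hae.mono fun v hv => max_eq_left (sub_nonneg.2 hv.2)),
      integral_sub (integrable_const _) (integrable_of_continuous_of_compl_Icc hμ continuous_id')]
    simp
  rw [slack, key F inferInstance hF.concentrated, key G inferInstance h.concentrated, h.mean_eq,
    sub_self]

/-- The constraint is slack at every atom, since the prior is atomless. -/
theorem IsMPC.slack_pos_of_atom {F G : Measure ℝ} (hF : IsPrior F) (h : IsMPC F G) {y : ℝ}
    (hy : 0 < G.real {y}) : y ∈ Ioo (0 : ℝ) 1 ∧ 0 < slack F G y := by
  have := hF.isProbabilityMeasure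
  have := h.isProbabilityMeasure
  have hy01 : y ∈ Icc (0 : ℝ) 1 := by
    by_contra hc
    refine hy.ne' ((measureReal_eq_zero_iff).2 (measure_mono_null ?_ h.concentrated))
    simpa using hc
  have hG : cdf G y = G.real (Iio y) + G.real {y} := by
    rw [cdf_eq_real, ← measureReal_union (by simp) (measurableSet_singleton y)]
    congr 1; ext t; simp [le_iff_lt_or_eq]
  suffices hs : 0 < slack F G y by
    refine ⟨⟨lt_of_le_of_ne hy01.1 ?_, lt_of_le_of_ne hy01.2 ?_⟩, hs⟩
    · rintro rfl
      rw [slack_zero] at hs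
      exact lt_irrefl _ hs
    · rintro rfl
      rw [h.slack_one hF] at hs
      exact lt_irrefl _ hs
  rcases lt_or_ge (cdf F y) (cdf G y) with hlt | hge
  · have hy1 : y < 1 := by
      refine lt_of_le_of_ne hy01.2 ?_
      rintro rfl
      rw [hF.cdf_one] at hlt
      exact absurd (cdf_le_one G 1) (not_le.2 hlt)
    have hev := (hF.continuous_cdf.continuousAt (x := y)).eventually_lt_const hlt
    obtain ⟨w, hw, hsub⟩ := (mem_nhdsGE_iff_exists_mem_Ioc_Ico_subset hy1).1
      (mem_nhdsWithin_of_mem_nhds hev)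
    have h1 := slack_lt_slack_of_lt_cdf (F := F) (G := G) hw.1 fun t ht =>
      (show cdf F t < cdf G y from hsub ⟨ht.1.le, ht.2⟩).trans_le (monotone_cdf G ht.1.le)
    exact (h.slack_nonneg ⟨by linarith [hy01.1, hw.1], hw.2⟩).trans_lt h1
  · have hy0 : 0 < y := by
      refine lt_of_le_of_ne hy01.1 ?_
      rintro rfl
      rw [hF.cdf_zero] at hge
      have : 0 ≤ G.real (Iio (0 : ℝ)) := measureReal_nonneg
      linarith
    have hlt : G.real (Iio y) < cdf F y := by linarith
    have hev := (hF.continuous_cdf.continuousAt (x := y)).eventually_const_lt hlt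
    obtain ⟨w, hw, hsub⟩ := (mem_nhdsLE_iff_exists_mem_Ico_Ioc_subset hy0).1
      (mem_nhdsWithin_of_mem_nhds hev)
    have h1 := slack_lt_slack_of_cdf_lt (F := F) (G := G) hw.2 fun t ht => by
      refine lt_of_le_of_lt ?_ (show G.real (Iio y) < cdf F t from hsub ⟨ht.1, ht.2.le⟩)
      rw [cdf_eq_real]
      exact measureReal_mono (Iic_subset_Iio.2 ht.2)
    exact (h.slack_nonneg ⟨hw.1, by linarith [hy01.2, hw.2]⟩).trans_lt h1

/-! ### Winning and visiting probabilities -/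

theorem winProb_nonneg (G : Measure ℝ) (n : ℕ) (v : ℝ) : 0 ≤ winProb n G v :=
  Finset.sum_nonneg fun k _ => by positivity

section winProb

variable {n : ℕ} (hn : 2 ≤ n) (G : Measure ℝ) [IsProbabilityMeasure G]

theorem measurable_winProb (n : ℕ) : Measurable (winProb n G) := by
  have h1 : Measurable fun v => G.real (Iio v) :=
    Monotone.measurable fun a b hab => measureReal_mono (Iio_subset_Iio hab)
  have h2 : Measurable fun v => G.real {v} := by
    have : (fun v => G.real {v}) = fun v => cdf G v - G.real (Iio v) := by
      ext v
      rw [cdf_eq_real, ← measureReal_sdiff (Iio_subset_Iic_self) measurableSet_Iio]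
      congr 1; ext t; simp [le_antisymm_iff]
    rw [this]
    exact (monotone_cdf G).measurable.sub h1
  unfold winProb
  exact Finset.measurable_sum _ fun k _ =>
    (((measurable_const.mul (h2.pow_const _)).mul (h1.pow_const _)).div_const _)

include hn

theorem sum_choose_eq_cdf_pow (v : ℝ) :
    ∑ k ∈ Finset.range n, ((n - 1).choose k : ℝ) * G.real {v} ^ k * G.real (Iio v) ^ (n - 1 - k)
      = cdf G v ^ (n - 1) := by
  have hG : cdf G v = G.real {v} + G.real (Iio v) := by
    rw [cdf_eq_real, add_comm, ← measureReal_union (by simp) (measurableSet_singleton v)]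
    congr 1; ext t; simp [le_iff_lt_or_eq]
  rw [hG, add_pow, Nat.sub_add_cancel (by omega)]
  exact Finset.sum_congr rfl fun k _ => by ring

theorem winProb_le_cdf_pow (v : ℝ) : winProb n G v ≤ cdf G v ^ (n - 1) := by
  rw [← sum_choose_eq_cdf_pow hn G v]
  refine Finset.sum_le_sum fun k _ => div_le_self (by positivity) ?_
  have : (0 : ℝ) ≤ k := by positivity
  linarith

theorem winProb_lt_cdf_pow {v : ℝ} (hv : 0 < G.real {v}) : winProb n G v < cdf G v ^ (n - 1) := by
  rw [← sum_choose_eq_cdf_pow hn G v]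
  refine Finset.sum_lt_sum (fun k _ => div_le_self (by positivity) ?_)
    ⟨n - 1, Finset.mem_range.2 (by omega), div_lt_self ?_ ?_⟩
  · have : (0 : ℝ) ≤ k := by positivity
    linarith
  · simp; positivity
  · have : (0 : ℝ) < (n - 1 : ℕ) := by exact_mod_cast (by omega : 0 < n - 1)
    linarith

theorem cdf_pow_le_winProb {y v : ℝ} (hyv : y < v) : cdf G y ^ (n - 1) ≤ winProb n G v := by
  have h0 : G.real (Iio v) ^ (n - 1) ≤ winProb n G v := by
    have := Finset.single_le_sum (f := fun k : ℕ => ((n - 1).choose k : ℝ) * G.real {v} ^ k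
      * G.real (Iio v) ^ (n - 1 - k) / ((k : ℝ) + 1)) (fun k _ => by positivity)
      (Finset.mem_range.2 (by omega : 0 < n))
    simpa [winProb] using this
  refine le_trans (pow_le_pow_left₀ (cdf_nonneg G y) ?_ _) h0
  rw [cdf_eq_real]
  exact measureReal_mono (Iic_subset_Iio.2 hyv)

theorem winProb_eq_cdf_pow [NullSingletonClass G] (v : ℝ) : winProb n G v = cdf G v ^ (n - 1) := by
  rw [← sum_choose_eq_cdf_pow hn G v]
  refine Finset.sum_congr rfl fun k _ => ?_
  rcases Nat.eq_zero_or_pos k with rfl | hk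
  · simp
  · simp [measureReal_def, hk.ne']

end winProb

theorem visitProb_pos {n : ℕ} (hn : 2 ≤ n) (r : ℝ) (G : Measure ℝ) :
    0 < visitProb n r G := by
  unfold visitProb
  have h0 : (0 : ℝ) < n := by exact_mod_cast (by omega : 0 < n)
  refine mul_pos (by positivity) (Finset.sum_pos' (fun k _ => by positivity)
    ⟨0, Finset.mem_range.2 (by omega), by simp⟩)

section visitProb

variable {n : ℕ} (hn : 2 ≤ n) (r : ℝ) (G : Measure ℝ) [IsProbabilityMeasure G]
include hn

theorem visitProb_le_one : visitProb n r G ≤ 1 := by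
  unfold visitProb
  have h0 : (0 : ℝ) < n := by exact_mod_cast (by omega : 0 < n)
  have : ∑ k ∈ Finset.range n, G.real (Iio r) ^ k ≤ ∑ k ∈ Finset.range n, (1 : ℝ) :=
    Finset.sum_le_sum fun k _ => pow_le_one₀ measureReal_nonneg measureReal_le_one
  rw [one_div, inv_mul_le_iff₀ h0]
  simpa using this

theorem pow_le_visitProb : G.real (Iio r) ^ (n - 1) ≤ visitProb n r G := by
  unfold visitProb
  have h0 : (0 : ℝ) < n := by exact_mod_cast (by omega : 0 < n)
  have : ∑ k ∈ Finset.range n, G.real (Iio r) ^ (n - 1)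
      ≤ ∑ k ∈ Finset.range n, G.real (Iio r) ^ k :=
    Finset.sum_le_sum fun k hk => pow_le_pow_of_le_one measureReal_nonneg measureReal_le_one
      (by have := Finset.mem_range.1 hk; omega)
  rw [one_div, le_inv_mul_iff₀ h0]
  simpa using this

theorem pow_lt_visitProb (hq : G.real (Iio r) < 1) :
    G.real (Iio r) ^ (n - 1) < visitProb n r G := by
  unfold visitProb
  have h0 : (0 : ℝ) < n := by exact_mod_cast (by omega : 0 < n)
  have : ∑ k ∈ Finset.range n, G.real (Iio r) ^ (n - 1)
      < ∑ k ∈ Finset.range n, G.real (Iio r) ^ k :=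
    Finset.sum_lt_sum (fun k hk => pow_le_pow_of_le_one measureReal_nonneg measureReal_le_one
      (by have := Finset.mem_range.1 hk; omega)) ⟨0, Finset.mem_range.2 (by omega), by
        simpa using pow_lt_one₀ measureReal_nonneg hq (by omega)⟩
  rw [one_div, lt_inv_mul_iff₀ h0]
  simpa using this

end visitProb

/-- The sale probability of a visited firm, multiplied by the probability `α η + (1 - α)` of a
visit, i.e. the unconditional sale probability. It is a positive multiple of `payoff`. -/
noncomputable def saleProb (n : ℕ) (α r : ℝ) (G : Measure ℝ) (v : ℝ) : ℝ :=
  if v < r then winProb n G v else α * visitProb n r G + (1 - α) * winProb n G v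

theorem payoff_eq_saleProb_div {n : ℕ} (hn : 2 ≤ n) {α : ℝ} (hα : α ∈ Ioo (0 : ℝ) 1) (r : ℝ)
    (G : Measure ℝ) (v : ℝ) :
    payoff n α r G v = saleProb n α r G v / (α * visitProb n r G + (1 - α)) := by
  have hη := visitProb_pos hn r G
  have hN : 0 < α * visitProb n r G + (1 - α) :=
    add_pos (mul_pos hα.1 hη) (sub_pos.2 hα.2)
  have h1 : visitBelief n α r G / visitProb n r G = α / (α * visitProb n r G + (1 - α)) := by
    unfold visitBelief; field_simp
  have h2 : 1 - visitBelief n α r G = (1 - α) / (α * visitProb n r G + (1 - α)) := by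
    unfold visitBelief; field_simp; ring
  unfold payoff saleProb
  rw [h1, h2]
  split_ifs
  · field_simp; ring
  · unfold visitBelief; field_simp

section saleProb

variable {n : ℕ} (hn : 2 ≤ n) {α : ℝ} (hα : α ∈ Ioo (0 : ℝ) 1) (r : ℝ) (G : Measure ℝ)
  [IsProbabilityMeasure G]

theorem measurable_saleProb (n : ℕ) (α : ℝ) : Measurable (saleProb n α r G) :=
  Measurable.ite measurableSet_Iio (measurable_winProb G n)
    (measurable_const.add (measurable_const.mul (measurable_winProb G n)))

include hn hα

theorem abs_saleProb_le_one (v : ℝ) : |saleProb n α r G v| ≤ 1 := by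
  have h0 := winProb_nonneg G n v
  have h1 : winProb n G v ≤ 1 := (winProb_le_cdf_pow hn G v).trans
    (pow_le_one₀ (cdf_nonneg G v) (cdf_le_one G v))
  have h2 := visitProb_pos hn r G
  have h3 := visitProb_le_one hn r G
  have h4 := hα.1
  have h5 := sub_pos.2 hα.2
  rw [abs_of_nonneg]
  · unfold saleProb
    split_ifs
    · exact h1
    · nlinarith
  · unfold saleProb
    split_ifs
    · exact h0
    · positivity

end saleProb

/-! ### Absence of atoms -/

namespace IsSymmetricEquilibrium

variable {n : ℕ} (hn : 2 ≤ n) {α : ℝ} (hα : α ∈ Ioo (0 : ℝ) 1) {r : ℝ} {F G : Measure ℝ}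
  (h : IsSymmetricEquilibrium n α r F G)
include hn hα h

theorem isOptimal : IsOptimal F G (saleProb n α r G) := by
  have := h.feasible.isProbabilityMeasure
  refine ⟨h.feasible, fun G' hG' => ?_⟩
  have h1 := h.optimal G' hG'
  simp_rw [payoff_eq_saleProb_div hn hα r G, integral_div] at h1
  exact (div_le_div_iff_of_pos_right
    (add_pos (mul_pos hα.1 (visitProb_pos hn r G)) (sub_pos.2 hα.2))).1 h1

/-- There are no atoms: the payoff would jump up just above an atom, while the constraint is slack
there, so splitting the atom between a point slightly above and a point below is profitable. -/
theorem nullSingletonClass (hF : IsPrior F) : NullSingletonClass G := by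
  have := h.feasible.isProbabilityMeasure
  refine ⟨fun y => ?_⟩
  by_contra hy0
  have hy : 0 < G.real {y} := ENNReal.toReal_pos hy0 (measure_ne_top _ _)
  obtain ⟨hy01, hs⟩ := h.feasible.slack_pos_of_atom hF hy
  -- just above `y` the payoff exceeds its value at `y` by at least `δ`
  obtain ⟨δ, hδ, z₀, hz₀, hjump⟩ : ∃ δ > 0, ∃ z₀ > y, ∀ z ∈ Ioo y z₀,
      saleProb n α r G y + δ ≤ saleProb n α r G z := by
    have hw := sub_pos.2 (winProb_lt_cdf_pow hn G hy)
    have hα1 := sub_pos.2 hα.2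
    rcases lt_or_ge y r with hyr | hyr
    · refine ⟨_, hw, r, hyr, fun z hz => ?_⟩
      rw [saleProb, saleProb, if_pos hyr, if_pos hz.2]
      linarith [cdf_pow_le_winProb hn G hz.1]
    · refine ⟨_, mul_pos hα1 hw, y + 1, by linarith, fun z hz => ?_⟩
      rw [saleProb, saleProb, if_neg (not_lt.2 hyr), if_neg (not_lt.2 (hyr.trans hz.1.le))]
      nlinarith [cdf_pow_le_winProb hn G hz.1]
  have hev : ∀ᶠ w in 𝓝 y, 0 < slack F G w ∧ w ∈ Ioo 0 1 :=
    ((continuous_slack F G).continuousAt.eventually_const_lt hs).and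
      (Ioo_mem_nhds hy01.1 hy01.2)
  obtain ⟨a, b, hab, hsub⟩ := mem_nhds_iff_exists_Ioo_subset.1 hev
  obtain ⟨x, hax, hxy⟩ := exists_between hab.1
  have hmain : ∀ z, y < z → z < min b z₀ → (y - x) * δ ≤ (z - y) * 1 := by
    intro z hyz hz
    have hzb := hz.trans_le (min_le_left _ _)
    have hpos : ∀ w ∈ Icc x z, 0 < slack F G w ∧ w ∈ Ioo (0 : ℝ) 1 := fun w hw =>
      hsub ⟨by linarith [hw.1], by linarith [hw.2]⟩
    have h1 := (h.isOptimal hn hα).setIntegral_chord_le (measurable_saleProb r G n α)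
      (abs_saleProb_le_one hn hα r G) (hpos x ⟨le_rfl, by linarith⟩).2.1.le (hxy.trans hyz)
      (hpos z ⟨by linarith, le_rfl⟩).2.2.le (fun w hw => (hpos w hw).1)
      (measurableSet_singleton y) (by simp; constructor <;> linarith)
    rw [integral_singleton, smul_eq_mul] at h1
    have h2 := nonpos_of_mul_nonpos_right h1 hy
    have h3 := hjump z ⟨hyz, hz.trans_le (min_le_right _ _)⟩
    have h4 := abs_le.1 (abs_saleProb_le_one hn hα r G y)
    have h5 : 0 ≤ saleProb n α r G x := by
      have := winProb_nonneg G n x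
      have := visitProb_pos hn r G
      have := hα.1
      have := sub_pos.2 hα.2
      unfold saleProb; split_ifs <;> positivity
    nlinarith [mul_nonneg (sub_pos.2 hyz).le h5]
  obtain ⟨z, hz1, hz2⟩ := exists_between
    (show y < min (min b z₀) (y + (y - x) * δ) from
      lt_min (lt_min hab.2 hz₀) (by linarith [mul_pos (sub_pos.2 hxy) hδ]))
  have := hmain z hz1 (hz2.trans_le (min_le_left _ _))
  linarith [hz2.trans_le (min_le_right _ _)]

end IsSymmetricEquilibrium

/-! ### Support lines on slack intervals -/

/-- On the interval `(c, e)` the payoff `u` lies weakly below the increasing line `k * v + l`, and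
it touches this line at every support point of `G`. -/
structure IsSupportLine (G : Measure ℝ) (u : ℝ → ℝ) (c e k l : ℝ) : Prop where
  slope_pos : 0 < k
  le : ∀ v ∈ Ioo c e, u v ≤ k * v + l
  eq : ∀ v ∈ Ioo c e, v ∈ G.support → u v = k * v + l

/-- On an interval where the constraint is slack, an optimal law concentrates on the contact set of
the payoff with a line: by spreading, the payoff at support points lies above chords, and by
pooling, chords between support points lie above the payoff. -/
theorem IsOptimal.exists_isSupportLine {F G : Measure ℝ} [NullSingletonClass G] {u : ℝ → ℝ}
    (h : IsOptimal F G u) (hu : Measurable u) {C : ℝ} (hC : ∀ v, |u v| ≤ C)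
    (husc : UpperSemicontinuous u) (hmono : ∀ a b, cdf G a < cdf G b → u a < u b)
    {c e : ℝ} (hc : 0 ≤ c) (he : e ≤ 1) (hpos : ∀ w ∈ Ioo c e, 0 < slack F G w)
    (hce : cdf G c < cdf G e) : ∃ k l, IsSupportLine G u c e k l := by
  have := h.feasible.isProbabilityMeasure
  have hGc := continuous_cdf_of_noAtoms G
  -- two support points `y₁ < y₂` with `G(y₁) < G(y₂)` determine the line
  obtain ⟨w₁, w₂, hw₁, hw₁₂, hw₂⟩ : ∃ w₁ w₂, cdf G c < cdf G w₁ ∧ cdf G w₁ < cdf G w₂ ∧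
      cdf G w₂ < cdf G e := by
    have hce' : c ≤ e := by
      by_contra! hlt
      exact absurd (monotone_cdf G hlt.le) (not_le.2 hce)
    have ivt : ∀ t ∈ Ioo (cdf G c) (cdf G e), ∃ w, cdf G w = t := fun t ht =>
      let ⟨w, _, hw⟩ := intermediate_value_Icc hce' hGc.continuousOn ⟨ht.1.le, ht.2.le⟩
      ⟨w, hw⟩
    obtain ⟨t₁, h1, h2⟩ := exists_between hce
    obtain ⟨t₂, h3, h4⟩ := exists_between h2
    obtain ⟨w₁, e1⟩ := ivt t₁ ⟨h1, h2⟩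
    obtain ⟨w₂, e2⟩ := ivt t₂ ⟨h1.trans h3, h4⟩
    exact ⟨w₁, w₂, by rw [e1]; exact h1, by rw [e1, e2]; exact h3, by rw [e2]; exact h4⟩
  obtain ⟨y₁, hy₁, hy₁c, hy₁w⟩ := exists_mem_support_of_cdf_lt G hw₁
  obtain ⟨y₂, hy₂, hy₂w, hy₂e⟩ := exists_mem_support_of_cdf_lt G hw₂
  have hG12 : cdf G y₁ < cdf G y₂ :=
    (monotone_cdf G hy₁w.le).trans_lt (hw₁₂.trans_le (monotone_cdf G hy₂w.le))
  have h12 : y₁ < y₂ := (monotone_cdf G).reflect_lt hG12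
  have hu12 := hmono _ _ hG12
  have hd : 0 < y₂ - y₁ := sub_pos.2 h12
  have above : ∀ x y z, c < x → x < y → y < z → z < e → y ∈ G.support →
      (z - y) * u x + (y - x) * u z ≤ (z - x) * u y := fun x y z hx hxy hyz hz hy =>
    h.chord_le_of_mem_support hu hC husc (hc.trans hx.le) hxy hyz (hz.le.trans he)
      (fun w hw => hpos w ⟨hx.trans_le hw.1, hw.2.trans_lt hz⟩) hy
  have below : ∀ x y z, x < y → y < z → x ∈ G.support → z ∈ G.support →
      (z - x) * u y ≤ (z - y) * u x + (y - x) * u z := fun x y z hxy hyz hx hz =>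
    h.le_chord_of_mem_support hu hC husc hxy hyz hx hz
  set k := (u y₂ - u y₁) / (y₂ - y₁) with hk
  have hkd : k * (y₂ - y₁) = u y₂ - u y₁ := div_mul_cancel₀ _ hd.ne'
  have hle : ∀ v ∈ Ioo c e, (y₂ - y₁) * u v ≤ (y₂ - v) * u y₁ + (v - y₁) * u y₂ := by
    intro v hv
    rcases lt_trichotomy v y₁ with hv1 | rfl | hv1
    · linarith [above v y₁ y₂ hv.1 hv1 h12 hy₂e hy₁]
    · linarith
    rcases lt_trichotomy v y₂ with hv2 | rfl | hv2
    · exact below y₁ v y₂ hv1 hv2 hy₁ hy₂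
    · linarith
    · linarith [above y₁ y₂ v hy₁c h12 hv2 hv.2 hy₂]
  have hge : ∀ v ∈ Ioo c e, v ∈ G.support →
      (y₂ - v) * u y₁ + (v - y₁) * u y₂ ≤ (y₂ - y₁) * u v := by
    intro v hv hvs
    rcases lt_trichotomy v y₁ with hv1 | rfl | hv1
    · linarith [below v y₁ y₂ hv1 h12 hvs hy₂]
    · linarith
    rcases lt_trichotomy v y₂ with hv2 | rfl | hv2
    · exact above y₁ v y₂ hy₁c hv1 hv2 hy₂e hvs
    · linarith
    · linarith [below y₁ y₂ v h12 hv2 hy₁ hvs]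
  have hline : ∀ v, (y₂ - y₁) * (k * v + (u y₁ - k * y₁))
      = (y₂ - v) * u y₁ + (v - y₁) * u y₂ := fun v => by
    linear_combination (v - y₁) * hkd
  refine ⟨k, u y₁ - k * y₁, div_pos (sub_pos.2 hu12) hd, fun v hv => ?_, fun v hv hvs => ?_⟩
  · exact le_of_mul_le_mul_left ((hle v hv).trans_eq (hline v).symm) hd
  · refine mul_left_cancel₀ hd.ne' ?_
    rw [hline]
    exact le_antisymm (hle v hv) (hge v hv hvs)

/-- Below a support point there is no gap in the support, as long as the payoff depends on `v` only
through `G(v)`: across a gap the payoff is constant, but the line is increasing. -/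
theorem IsSupportLine.mem_support_of_le {G : Measure ℝ} [IsProbabilityMeasure G]
    [NullSingletonClass G] {u : ℝ → ℝ} {c e k l : ℝ} (h : IsSupportLine G u c e k l) {v z : ℝ}
    (hcv : c < v) (hvz : v ≤ z) (hze : z < e) (hz : z ∈ G.support)
    (hconst : ∀ w ∈ Icc v z, cdf G w = cdf G v → u w = u v) : v ∈ G.support := by
  by_contra hv
  obtain ⟨z', ⟨hz's, hz'v⟩, hmin⟩ := (isCompact_Icc.inter_left G.isClosed_support).exists_isLeast
    (s := G.support ∩ Icc v z) ⟨z, hz, hvz, le_rfl⟩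
  have hlt : v < z' := lt_of_le_of_ne hz'v.1 (by rintro rfl; exact hv hz's)
  have heq : cdf G z' = cdf G v := by
    refine le_antisymm ?_ (monotone_cdf G hlt.le)
    by_contra! hc
    obtain ⟨y, hys, hvy, hyz⟩ := exists_mem_support_of_cdf_lt G hc
    exact absurd (hmin ⟨hys, hvy.le, hyz.le.trans hz'v.2⟩) (not_le.2 hyz)
  have h1 := hconst z' hz'v heq
  have h2 := h.eq z' ⟨hcv.trans hlt, hz'v.2.trans_lt hze⟩ hz's
  have h3 := h.le v ⟨hcv, hlt.trans (hz'v.2.trans_lt hze)⟩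
  have := mul_lt_mul_of_pos_left hlt h.slope_pos
  linarith

section Slack

variable {F G : Measure ℝ} (hF : IsPrior F) (h : IsMPC F G)
include hF h

/-- A point where the constraint is slack lies in a maximal interval of such points. -/
theorem IsMPC.exists_slack_component {y : ℝ} (hy : y ∈ Icc (0 : ℝ) 1) (hs : 0 < slack F G y) :
    ∃ c e, 0 ≤ c ∧ c < y ∧ y < e ∧ e ≤ 1 ∧ slack F G c = 0 ∧ slack F G e = 0 ∧
      ∀ w ∈ Ioo c e, 0 < slack F G w := by
  have hcl : IsClosed {w | slack F G w = 0} :=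
    isClosed_eq (continuous_slack F G) continuous_const
  obtain ⟨c, ⟨hc0, hc⟩, hcmax⟩ := (isCompact_Icc.inter_left hcl).exists_isGreatest
    (s := {w | slack F G w = 0} ∩ Icc 0 y) ⟨0, slack_zero F G, le_rfl, hy.1⟩
  obtain ⟨e, ⟨he0, he⟩, hemin⟩ := (isCompact_Icc.inter_left hcl).exists_isLeast
    (s := {w | slack F G w = 0} ∩ Icc y 1) ⟨1, h.slack_one hF, hy.2, le_rfl⟩
  have hc0 : slack F G c = 0 := hc0
  have he0 : slack F G e = 0 := he0
  refine ⟨c, e, hc.1, lt_of_le_of_ne hc.2 ?_, lt_of_le_of_ne he.1 ?_, he.2, hc0, he0, ?_⟩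
  · rintro rfl; exact hs.ne' hc0
  · rintro rfl; exact hs.ne' he0
  · intro w hw
    refine lt_of_le_of_ne
      (h.slack_nonneg ⟨hc.1.trans hw.1.le, hw.2.le.trans he.2⟩) fun hw0 => ?_
    rcases le_total w y with hwy | hwy
    · exact absurd (hcmax ⟨hw0.symm, hc.1.trans hw.1.le, hwy⟩) (not_le.2 hw.1)
    · exact absurd (hemin ⟨hw0.symm, hwy, hw.2.le.trans he.2⟩) (not_le.2 hw.2)

variable [NullSingletonClass G]

/-- Where the constraint binds, the two distribution functions agree, by the first-order condition
for a minimum of the slack. -/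
theorem IsMPC.cdf_eq_of_slack_eq_zero {v : ℝ} (hv : v ∈ Icc (0 : ℝ) 1) (hs : slack F G v = 0) :
    cdf G v = cdf F v := by
  have := h.isProbabilityMeasure
  have hGc := continuous_cdf_of_noAtoms G
  rcases eq_or_lt_of_le hv.1 with rfl | h0
  · rw [hF.cdf_zero, cdf_zero_of_measure_singleton h.concentrated (measure_singleton 0)]
  rcases eq_or_lt_of_le hv.2 with rfl | h1
  · rw [hF.cdf_one, cdf_one h.concentrated]
  have hder : HasDerivAt (slack F G) (cdf F v - cdf G v) v :=
    (intervalIntegral.integral_hasDerivAt_right ((monotone_cdf F).intervalIntegrable)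
      (hF.continuous_cdf.stronglyMeasurableAtFilter _ _) hF.continuous_cdf.continuousAt).sub
    (intervalIntegral.integral_hasDerivAt_right ((monotone_cdf G).intervalIntegrable)
      (hGc.stronglyMeasurableAtFilter _ _) hGc.continuousAt)
  have hmin : IsLocalMin (slack F G) v := by
    filter_upwards [Ioo_mem_nhds h0 h1] with w hw
    rw [hs]
    exact h.slack_nonneg ⟨hw.1.le, hw.2.le⟩
  linarith [hmin.hasDerivAt_eq_zero hder]

end Slack

/-- There is no maximal slack interval `(c, e)` on which the payoff is an increasing affine function
of `G ^ m`: on it `G ^ m` would lie above the chord of the convex function `F ^ m`, so `F ≤ G`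
there, and the slack could not become positive. -/
theorem IsOptimal.not_slack_of_affine {F G : Measure ℝ} [NullSingletonClass G] {u : ℝ → ℝ}
    (hopt : IsOptimal F G u) (hF : IsPrior F) (hu : Measurable u)
    {C : ℝ} (hC : ∀ v, |u v| ≤ C) (husc : UpperSemicontinuous u)
    (hmono : ∀ a b, cdf G a < cdf G b → u a < u b) {m : ℕ} (hm : m ≠ 0)
    (hconv : ConvexOn ℝ (Icc (0 : ℝ) 1) (fun v => cdf F v ^ m))
    {c e : ℝ} (hc : 0 ≤ c) (hce : c < e) (he : e ≤ 1) (hc0 : slack F G c = 0)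
    (he0 : slack F G e = 0) (hpos : ∀ w ∈ Ioo c e, 0 < slack F G w) {A B : ℝ} (hB : 0 < B)
    (hAB : ∀ v ∈ Ioo c e, u v = A + B * cdf G v ^ m) : False := by
  have h := hopt.feasible
  have := h.isProbabilityMeasure
  have hGc := continuous_cdf_of_noAtoms G
  have hc01 : c ∈ Icc (0 : ℝ) 1 := ⟨hc, hce.le.trans he⟩
  have he01 : e ∈ Icc (0 : ℝ) 1 := ⟨hc.trans hce.le, he⟩
  have hGFc := h.cdf_eq_of_slack_eq_zero hF hc01 hc0
  have hGFe := h.cdf_eq_of_slack_eq_zero hF he01 he0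
  have hlt : cdf G c < cdf G e := by
    rw [hGFc, hGFe]; exact hF.cdf_lt_cdf hc hce he
  obtain ⟨k, l, hline⟩ := hopt.exists_isSupportLine hu hC husc hmono hc he hpos hlt
  have hleI : ∀ v ∈ Icc c e, A + B * cdf G v ^ m ≤ k * v + l := by
    have hcl : IsClosed {v | A + B * cdf G v ^ m ≤ k * v + l} :=
      isClosed_le (by fun_prop) (by fun_prop)
    intro v hv
    rw [← closure_Ioo hce.ne] at hv
    exact closure_minimal (fun w hw => (hAB w hw).symm.trans_le (hline.le w hw)) hcl hv
  have hFG : ∀ v ∈ Ioo c e, cdf F v ≤ cdf G v := by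
    intro v hv
    by_cases hz : ∃ z ∈ G.support, v < z ∧ z < e
    · obtain ⟨z, hzs, hvz, hze⟩ := hz
      have hvs := hline.mem_support_of_le hv.1 hvz.le hze hzs fun w hw hwG => by
        rw [hAB w ⟨hv.1.trans_le hw.1, hw.2.trans_lt hze⟩, hAB v hv, hwG]
      have h1 := hline.eq v hv hvs
      rw [hAB v hv] at h1
      refine le_of_pow_le_pow_left₀ hm (cdf_nonneg G v) ?_
      refine le_of_mul_le_mul_left ?_ hB
      have h2 := hleI c ⟨le_rfl, hce.le⟩
      have h3 := hleI e ⟨hce.le, le_rfl⟩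
      rw [hGFc] at h2
      rw [hGFe] at h3
      have hd : 0 < e - c := sub_pos.2 hce
      have h4 := hconv.2 hc01 he01 (div_nonneg (sub_nonneg.2 hv.2.le) hd.le)
        (div_nonneg (sub_nonneg.2 hv.1.le) hd.le) (by field_simp; ring)
      have h5 : (e - v) / (e - c) * c + (v - c) / (e - c) * e = v := by field_simp; ring
      simp only [smul_eq_mul] at h4
      rw [h5, div_mul_eq_mul_div, div_mul_eq_mul_div, ← add_div, le_div_iff₀ hd] at h4
      nlinarith [mul_le_mul_of_nonneg_left h2 (sub_nonneg.2 hv.2.le),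
        mul_le_mul_of_nonneg_left h3 (sub_nonneg.2 hv.1.le), mul_le_mul_of_nonneg_left h4 hB.le]
    · have hGe : cdf G e ≤ cdf G v := by
        by_contra! hc
        obtain ⟨y, hys, h1, h2⟩ := exists_mem_support_of_cdf_lt G hc
        exact hz ⟨y, hys, h1, h2⟩
      exact (monotone_cdf F hv.2.le).trans (hGFe.symm.trans_le hGe)
  obtain ⟨w, hw1, hw2⟩ := exists_between hce
  have h1 := slack_le_slack_of_cdf_le hw1.le fun t ht => hFG t ⟨ht.1, ht.2.trans hw2⟩
  linarith [hpos w ⟨hw1, hw2⟩]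

/-! ### The probability integral transform -/

/-- The probability integral transform: an atomless law is mapped to the uniform law by its
distribution function. -/
theorem map_cdf_eq_uniform (μ : Measure ℝ) [IsProbabilityMeasure μ] [NullSingletonClass μ] :
    μ.map (cdf μ) = volume.restrict (Ioc (0 : ℝ) 1) := by
  have hc := continuous_cdf_of_noAtoms μ
  have : IsProbabilityMeasure (μ.map (cdf μ)) :=
    Measure.isProbabilityMeasure_map hc.measurable.aemeasurable
  have hsurj : ∀ t ∈ Ioo (0 : ℝ) 1, ∃ v, cdf μ v = t := by
    intro t ht
    obtain ⟨a, ha⟩ := ((tendsto_cdf_atBot μ).eventually_lt_const ht.1).exists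
    obtain ⟨b, hb⟩ := ((tendsto_cdf_atTop μ).eventually_const_lt ht.2).exists
    exact mem_range_of_exists_le_of_exists_ge hc ⟨a, ha.le⟩ ⟨b, hb.le⟩
  refine Measure.ext_of_Iic _ _ fun a => ?_
  rw [Measure.map_apply hc.measurable measurableSet_Iic, Measure.restrict_apply measurableSet_Iic,
    inter_comm, Ioc_inter_Iic, Real.volume_Ioc, sub_zero]
  rcases lt_or_ge a 0 with ha0 | ha0
  · rw [ENNReal.ofReal_of_nonpos ((min_le_right _ _).trans ha0.le)]
    convert measure_empty (μ := μ)
    ext v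
    simpa using ha0.trans_le (cdf_nonneg μ v)
  rcases le_or_gt 1 a with ha1 | ha1
  · rw [min_eq_left ha1, ENNReal.ofReal_one]
    convert measure_univ (μ := μ)
    ext v
    simpa using (cdf_le_one μ v).trans ha1
  rw [min_eq_right ha1.le]
  refine le_antisymm ?_ ?_
  · rw [← ofReal_measureReal]
    refine ENNReal.ofReal_le_ofReal (le_of_forall_gt_imp_ge_of_dense fun t hat => ?_)
    rcases lt_or_ge t 1 with ht1 | ht1
    · obtain ⟨v, hv⟩ := hsurj t ⟨ha0.trans_lt hat, ht1⟩
      rw [← hv, cdf_eq_real μ v]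
      refine measureReal_mono fun w hw => ?_
      exact ((monotone_cdf μ).reflect_lt ((mem_Iic.1 hw).trans_lt (hv.symm ▸ hat))).le
    · exact measureReal_le_one.trans ht1
  · rcases eq_or_lt_of_le ha0 with rfl | ha0
    · simp
    · obtain ⟨v, rfl⟩ := hsurj a ⟨ha0, ha1⟩
      rw [ofReal_cdf]
      exact measure_mono fun w hw => monotone_cdf μ hw

theorem integral_comp_cdf (μ : Measure ℝ) [IsProbabilityMeasure μ] [NullSingletonClass μ]
    {φ : ℝ → ℝ} (hφ : Measurable φ) : ∫ v, φ (cdf μ v) ∂μ = ∫ t in (0 : ℝ)..1, φ t := by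
  rw [intervalIntegral.integral_of_le zero_le_one, ← map_cdf_eq_uniform μ,
    integral_map (continuous_cdf_of_noAtoms μ).measurable.aemeasurable hφ.aestronglyMeasurable]

theorem integral_cdf_pow (μ : Measure ℝ) [IsProbabilityMeasure μ] [NullSingletonClass μ] {n : ℕ}
    (hn : 2 ≤ n) : ∫ v, cdf μ v ^ (n - 1) ∂μ = 1 / n := by
  have h1 : n - 1 + 1 = n := by omega
  rw [integral_comp_cdf μ (φ := fun t => t ^ (n - 1)) (by fun_prop), integral_pow, h1, one_pow,
    zero_pow (by omega), ← h1]
  push_cast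
  simp

/-! ### The sale probability of an atomless law -/

section saleProb

variable {n : ℕ} (hn : 2 ≤ n) {α : ℝ} (hα : α ∈ Ioo (0 : ℝ) 1) (r : ℝ) (G : Measure ℝ)
  [IsProbabilityMeasure G] [NullSingletonClass G]

theorem measureReal_Iio_eq_cdf (v : ℝ) : G.real (Iio v) = cdf G v := by
  rw [cdf_eq_real, measureReal_congr (Iio_ae_eq_Iic (μ := G))]

include hn

theorem saleProb_of_lt (α : ℝ) {r v : ℝ} (hv : v < r) :
    saleProb n α r G v = cdf G v ^ (n - 1) := by
  rw [saleProb, if_pos hv, winProb_eq_cdf_pow hn]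

theorem saleProb_of_ge (α : ℝ) {r v : ℝ} (hv : r ≤ v) :
    saleProb n α r G v = α * visitProb n r G + (1 - α) * cdf G v ^ (n - 1) := by
  rw [saleProb, if_neg (not_lt.2 hv), winProb_eq_cdf_pow hn]

theorem cdf_pow_le_visitProb : cdf G r ^ (n - 1) ≤ visitProb n r G := by
  rw [← measureReal_Iio_eq_cdf]; exact pow_le_visitProb hn r G

theorem cdf_pow_lt_visitProb (h : cdf G r < 1) : cdf G r ^ (n - 1) < visitProb n r G := by
  rw [← measureReal_Iio_eq_cdf] at h ⊢; exact pow_lt_visitProb hn r G h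

/-- Some firm always sells, so by symmetry a firm that plays `G` as its rivals do sells with
probability `1 / n`. -/
theorem integral_saleProb : ∫ v, saleProb n α r G v ∂G = 1 / n := by
  have hGc := continuous_cdf_of_noAtoms G
  set q := cdf G r with hq
  have hq0 : 0 ≤ q := cdf_nonneg G r
  have hq1 : q ≤ 1 := cdf_le_one G r
  set η := visitProb n r G with hη
  set φ : ℝ → ℝ := fun t => if t < q then t ^ (n - 1) else α * η + (1 - α) * t ^ (n - 1) with hφ
  have hφm : Measurable φ :=
    Measurable.ite measurableSet_Iio (by fun_prop) (by fun_prop)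
  have hne : ∀ᵐ v ∂G, cdf G v ≠ q := by
    have h1 : G.map (cdf G) {q} = 0 := by rw [map_cdf_eq_uniform G]; exact measure_singleton q
    rw [Measure.map_apply hGc.measurable (measurableSet_singleton q)] at h1
    rw [ae_iff]
    simp only [ne_eq, not_not]
    exact h1
  have h1 : ∫ v, saleProb n α r G v ∂G = ∫ v, φ (cdf G v) ∂G := by
    refine integral_congr_ae (hne.mono fun v hv => ?_)
    rcases lt_or_ge v r with hvr | hvr
    · simp only [hφ]
      rw [saleProb_of_lt hn G α hvr, if_pos (lt_of_le_of_ne (monotone_cdf G hvr.le) hv)]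
    · simp only [hφ]
      rw [saleProb_of_ge hn G α hvr, if_neg (not_lt.2 (monotone_cdf G hvr))]
  have e1 : EqOn φ (fun t => t ^ (n - 1)) (Ioo 0 q) := fun t ht => if_pos ht.2
  have e2 : EqOn φ (fun t => α * η + (1 - α) * t ^ (n - 1)) (Ioo q 1) :=
    fun t ht => if_neg (not_lt.2 ht.1.le)
  have c1 : Continuous fun t : ℝ => t ^ (n - 1) := by fun_prop
  have c2 : Continuous fun t : ℝ => α * η + (1 - α) * t ^ (n - 1) := by fun_prop
  have i1 : IntervalIntegrable φ volume 0 q :=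
    (c1.intervalIntegrable _ _).congr_uIoo (by rw [uIoo_of_le hq0]; exact e1.symm)
  have i2 : IntervalIntegrable φ volume q 1 :=
    (c2.intervalIntegrable _ _).congr_uIoo (by rw [uIoo_of_le hq1]; exact e2.symm)
  have h2 : n - 1 + 1 = n := by omega
  have hn0 : (n : ℝ) ≠ 0 := by exact_mod_cast (by omega : n ≠ 0)
  have hcast : ((n - 1 : ℕ) : ℝ) + 1 = n := by exact_mod_cast h2
  -- `η * (1 - q) = (1 - q ^ n) / n` is a geometric sum
  have hgeom : η * (1 - q) * n = 1 - q ^ n := by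
    rw [hη, visitProb, measureReal_Iio_eq_cdf, ← hq, ← mul_neg_geom_sum q n]
    field_simp
  rw [h1, integral_comp_cdf G hφm, ← intervalIntegral.integral_add_adjacent_intervals i1 i2,
    intervalIntegral.integral_congr_Ioo_of_le hq0 e1,
    intervalIntegral.integral_congr_Ioo_of_le hq1 e2, integral_pow,
    intervalIntegral.integral_add intervalIntegrable_const
      ((c1.intervalIntegrable _ _).const_mul _), intervalIntegral.integral_const,
    intervalIntegral.integral_const_mul, integral_pow, h2, hcast, zero_pow (by omega), one_pow,
    smul_eq_mul]
  field_simp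
  linear_combination α * hgeom

include hα

theorem saleProb_lt_saleProb {a b : ℝ} (h : cdf G a < cdf G b) :
    saleProb n α r G a < saleProb n α r G b := by
  have hab : a < b := (monotone_cdf G).reflect_lt h
  have hp : cdf G a ^ (n - 1) < cdf G b ^ (n - 1) :=
    pow_lt_pow_left₀ h (cdf_nonneg G a) (by omega)
  have hα0 := hα.1
  have hα1 := sub_pos.2 hα.2
  rcases lt_or_ge b r with hb | hb
  · rwa [saleProb_of_lt hn G α hb, saleProb_of_lt hn G α (hab.trans hb)]
  rcases lt_or_ge a r with ha | ha
  · rw [saleProb_of_lt hn G α ha, saleProb_of_ge hn G α hb]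
    have h1 := cdf_pow_le_visitProb hn r G
    have h2 := pow_le_pow_left₀ (cdf_nonneg G a) (monotone_cdf G ha.le) (n - 1)
    nlinarith [mul_le_mul_of_nonneg_left (h2.trans h1) hα0.le, mul_lt_mul_of_pos_left hp hα1]
  · rw [saleProb_of_ge hn G α ha, saleProb_of_ge hn G α hb]
    nlinarith

/-- The only discontinuity of the sale probability is an upward jump at the reservation value,
where it is right-continuous. -/
theorem upperSemicontinuous_saleProb : UpperSemicontinuous (saleProb n α r G) := by
  have hGc := continuous_cdf_of_noAtoms G
  have hcl : Continuous fun v => cdf G v ^ (n - 1) := by fun_prop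
  have hcr : Continuous fun v => α * visitProb n r G + (1 - α) * cdf G v ^ (n - 1) := by fun_prop
  intro x y hxy
  rcases lt_trichotomy x r with hx | rfl | hx
  · rw [saleProb_of_lt hn G α hx] at hxy
    filter_upwards [Iio_mem_nhds hx, hcl.continuousAt.eventually_lt_const hxy] with v h1 h2
    rwa [saleProb_of_lt hn G α h1]
  · rw [saleProb_of_ge hn G α le_rfl] at hxy
    have h0 : cdf G x ^ (n - 1) < y := by
      refine lt_of_le_of_lt ?_ hxy
      nlinarith [mul_le_mul_of_nonneg_left (cdf_pow_le_visitProb hn x G) hα.1.le]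
    filter_upwards [hcl.continuousAt.eventually_lt_const h0,
      hcr.continuousAt.eventually_lt_const hxy] with v h1 h2
    rcases lt_or_ge v x with hv | hv
    · rwa [saleProb_of_lt hn G α hv]
    · rwa [saleProb_of_ge hn G α hv]
  · rw [saleProb_of_ge hn G α hx.le] at hxy
    filter_upwards [Ioi_mem_nhds hx, hcr.continuousAt.eventually_lt_const hxy] with v h1 h2
    rwa [saleProb_of_ge hn G α (mem_Ioi.1 h1).le]

end saleProb

theorem ConvexOn.lt_of_line_le_of_line_lt {H : ℝ → ℝ} {s : Set ℝ} (hH : ConvexOn ℝ s H)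
    {a v x k l : ℝ} (ha : a ∈ s) (hx : x ∈ s) (hav : a < v) (hvx : v < x) (h1 : H a ≤ k * a + l)
    (h2 : k * v + l < H v) : k * x + l < H x := by
  have hd : 0 < x - a := by linarith
  have h4 := hH.2 ha hx (div_nonneg (sub_nonneg.2 hvx.le) hd.le)
    (div_nonneg (sub_nonneg.2 hav.le) hd.le) (by field_simp; ring)
  have h5 : (x - v) / (x - a) * a + (v - a) / (x - a) * x = v := by field_simp; ring
  simp only [smul_eq_mul] at h4
  rw [h5, div_mul_eq_mul_div, div_mul_eq_mul_div, ← add_div, le_div_iff₀ hd] at h4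
  have h6 := mul_le_mul_of_nonneg_left h1 (sub_nonneg.2 hvx.le)
  have h7 := mul_lt_mul_of_pos_right h2 hd
  refine lt_of_mul_lt_mul_left (a := v - a) ?_ (sub_pos.2 hav).le
  nlinarith

theorem restrict_Iic_eq_of_cdf_eq {μ ν : Measure ℝ} [IsProbabilityMeasure μ]
    [IsProbabilityMeasure ν] {b : ℝ} (h : ∀ v ≤ b, cdf μ v = cdf ν v) :
    μ.restrict (Iic b) = ν.restrict (Iic b) := by
  refine Measure.ext_of_Iic _ _ fun a => ?_
  rw [Measure.restrict_apply measurableSet_Iic, Measure.restrict_apply measurableSet_Iic,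
    Iic_inter_Iic, ← ofReal_cdf, ← ofReal_cdf, h _ inf_le_right]

theorem restrict_Ioi_eq_of_cdf_eq {μ ν : Measure ℝ} [IsProbabilityMeasure μ]
    [IsProbabilityMeasure ν] {b : ℝ} (h : ∀ v, b ≤ v → cdf μ v = cdf ν v) :
    μ.restrict (Ioi b) = ν.restrict (Ioi b) := by
  refine Measure.ext_of_Iic _ _ fun a => ?_
  rw [Measure.restrict_apply measurableSet_Iic, Measure.restrict_apply measurableSet_Iic,
    inter_comm, Ioi_inter_Iic]
  rcases lt_or_ge a b with hab | hab
  · simp [Ioc_eq_empty (not_lt.2 hab.le)]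
  · have key : ∀ (κ : Measure ℝ) [IsProbabilityMeasure κ],
        κ (Ioc b a) = ENNReal.ofReal (cdf κ a - cdf κ b) := fun κ _ => by
      rw [← StieltjesFunction.measure_Ioc, measure_cdf]
    rw [key, key, h a hab, h b le_rfl]

/-! ### The slack interval of an equilibrium -/

namespace IsSymmetricEquilibrium

section

variable {n : ℕ} (hn : 2 ≤ n) {α : ℝ} (hα : α ∈ Ioo (0 : ℝ) 1) {r : ℝ} (hr : r ∈ Ioo (0 : ℝ) 1)
  {F G : Measure ℝ} (hF : IsPrior F)
  (hconv : ConvexOn ℝ (Icc (0 : ℝ) 1) (fun v => cdf F v ^ (n - 1)))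
  (h : IsSymmetricEquilibrium n α r F G) [NullSingletonClass G]
include hn hα hF hconv h

/-- Every maximal interval on which the constraint is slack contains the reservation value, because
on either side of `r` the payoff is affine in `G ^ (n - 1)`. -/
theorem reservation_mem_of_slack {c e : ℝ} (hc : 0 ≤ c) (hce : c < e) (he : e ≤ 1)
    (hc0 : slack F G c = 0) (he0 : slack F G e = 0) (hpos : ∀ w ∈ Ioo c e, 0 < slack F G w) :
    r ∈ Ioo c e := by
  have := h.feasible.isProbabilityMeasure
  have key := fun A B => (h.isOptimal hn hα).not_slack_of_affine (A := A) (B := B) hF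
    (measurable_saleProb r G n α) (abs_saleProb_le_one hn hα r G)
    (upperSemicontinuous_saleProb hn hα r G) (fun _ _ => saleProb_lt_saleProb hn hα r G)
    (m := n - 1) (by omega) hconv hc hce he hc0 he0 hpos
  constructor
  · by_contra! hrc
    exact key _ _ (sub_pos.2 hα.2) fun v hv => saleProb_of_ge hn G α (hrc.trans hv.1.le)
  · by_contra! hre
    exact key 0 1 one_pos fun v hv => by
      rw [saleProb_of_lt hn G α (hv.2.trans_le hre), zero_add, one_mul]

/-- The support has a gap below the reservation value. Otherwise `G ^ (n - 1)` starts out on the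
support line of the payoff, and convexity puts `F ^ (n - 1)` strictly above this line on the slack
interval. As `F` and `G` give the line the same integral, the expected payoff from `G` would be
less than `∫ F ^ (n - 1) dF`, but both are equal to `1 / n`. -/
theorem notMem_support_of_mem_Ioo {c e k l : ℝ} (hc : 0 ≤ c) (hre : r < e) (he : e ≤ 1)
    (hpos : ∀ w ∈ Ioo c e, 0 < slack F G w)
    (hzero : ∀ v ∈ Icc (0 : ℝ) 1, v ∉ Ioo c e → slack F G v = 0)
    (hline : IsSupportLine G (saleProb n α r G) c e k l) {y : ℝ} (hy : y ∈ Ioo c r) :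
    y ∉ G.support := by
  intro hys
  have := hF.isProbabilityMeasure
  have := hF.nullSingletonClass
  have := h.feasible.isProbabilityMeasure
  have hGc := continuous_cdf_of_noAtoms G
  have hFc := hF.continuous_cdf
  have hye : y < e := hy.2.trans hre
  have hce : c < e := hy.1.trans hye
  have hc01 : c ∈ Icc (0 : ℝ) 1 := ⟨hc, hce.le.trans he⟩
  have hGF : ∀ v ∈ Icc (0 : ℝ) 1, v ∉ Ioo c e → cdf G v = cdf F v := fun v hv hvn =>
    h.feasible.cdf_eq_of_slack_eq_zero hF hv (hzero v hv hvn)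
  have hGFc : ∀ v ≤ c, cdf G v = cdf F v := by
    intro v hv
    rcases le_or_gt 0 v with h0 | h0
    · exact hGF v ⟨h0, hv.trans hc01.2⟩ fun hvm => absurd hvm.1 (not_lt.2 hv)
    · have h1 := monotone_cdf G h0.le
      have h2 := monotone_cdf F h0.le
      rw [hGF 0 ⟨le_rfl, zero_le_one⟩ fun hvm => absurd hvm.1 (not_lt.2 hc)] at h1
      rw [hF.cdf_zero] at h1 h2
      rw [le_antisymm h1 (cdf_nonneg G v), le_antisymm h2 (cdf_nonneg F v)]
  have hGFe : ∀ v, e ≤ v → cdf G v = cdf F v := by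
    intro v hv
    rcases le_or_gt v 1 with h0 | h0
    · exact hGF v ⟨by linarith, h0⟩ fun hvm => absurd hvm.2 (not_lt.2 hv)
    · have h1 := monotone_cdf G h0.le
      have h2 := monotone_cdf F h0.le
      rw [cdf_one h.feasible.concentrated] at h1
      rw [hF.cdf_one] at h2
      rw [le_antisymm (cdf_le_one G v) h1, le_antisymm (cdf_le_one F v) h2]
  set U := saleProb n α r G with hU
  have hgline : ∀ v ∈ Ioc c y, cdf G v ^ (n - 1) = k * v + l := by
    intro v hv
    have hvr := hv.2.trans_lt hy.2
    have hvs := hline.mem_support_of_le hv.1 hv.2 hye hys fun w hw hwG => by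
      rw [hU, saleProb_of_lt hn G α (hw.2.trans_lt hy.2), saleProb_of_lt hn G α hvr, hwG]
    rw [← hline.eq v ⟨hv.1, hv.2.trans_lt hye⟩ hvs, hU, saleProb_of_lt hn G α hvr]
  have hHc : cdf F c ^ (n - 1) ≤ k * c + l := by
    rw [← hGFc c le_rfl]
    have hcl : IsClosed {v | cdf G v ^ (n - 1) ≤ k * v + l} :=
      isClosed_le (by fun_prop) (by fun_prop)
    refine closure_minimal (fun w hw => (hgline w ⟨hw.1, hw.2.le⟩).le) hcl
      (?_ : c ∈ closure (Ioo c y))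
    rw [closure_Ioo hy.1.ne]
    exact ⟨le_rfl, hy.1.le⟩
  have hlineH : ∀ x ∈ Ioo c e, k * x + l < cdf F x ^ (n - 1) := by
    intro x hx
    have hcm : c < min x y := lt_min hx.1 hy.1
    obtain ⟨v, hv, hvG⟩ : ∃ v ∈ Ioo c (min x y), cdf G v < cdf F v := by
      by_contra! hcon
      have h1 := slack_le_slack_of_cdf_le hcm.le hcon
      rw [hzero c hc01 fun hm => lt_irrefl _ hm.1] at h1
      exact absurd (hpos (min x y) ⟨hcm, (min_le_left _ _).trans_lt hx.2⟩) (not_lt.2 h1)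
    refine hconv.lt_of_line_le_of_line_lt hc01 ⟨hc.trans hx.1.le, hx.2.le.trans he⟩ hv.1
      (hv.2.trans_le (min_le_left _ _)) hHc ?_
    rw [← hgline v ⟨hv.1, hv.2.le.trans (min_le_right _ _)⟩]
    exact pow_lt_pow_left₀ hvG (cdf_nonneg G v) (by omega)
  have hηe : visitProb n r G ≤ cdf F e ^ (n - 1) := by
    have hcl : IsClosed {v | α * visitProb n r G + (1 - α) * cdf G v ^ (n - 1)
        ≤ cdf F v ^ (n - 1)} := isClosed_le (by fun_prop) (by fun_prop)
    have h1 : e ∈ closure (Ioo r e) := by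
      rw [closure_Ioo hre.ne]; exact ⟨hre.le, le_rfl⟩
    have h2 := closure_minimal (fun w hw => ?_) hcl h1
    · have h2 : α * visitProb n r G + (1 - α) * cdf G e ^ (n - 1) ≤ cdf F e ^ (n - 1) := h2
      rw [hGFe e le_rfl] at h2
      refine le_of_mul_le_mul_left ?_ hα.1
      linarith
    · have hw' : w ∈ Ioo c e := ⟨(hy.1.trans hy.2).trans hw.1, hw.2⟩
      have h3 := hline.le w hw'
      rw [hU, saleProb_of_ge hn G α hw.1.le] at h3
      exact h3.trans (hlineH w hw').le
  -- comparison of the two integrals, piece by piece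
  have hUi : ∀ (μ : Measure ℝ) [IsProbabilityMeasure μ], Integrable U μ := fun μ _ =>
    integrable_of_bounded (measurable_saleProb r G n α) (abs_saleProb_le_one hn hα r G)
  have hHi : Integrable (fun v => cdf F v ^ (n - 1)) F :=
    integrable_of_continuous_of_compl_Icc hF.concentrated (by fun_prop)
  have hli : ∀ (μ : Measure ℝ) [IsProbabilityMeasure μ], μ (Icc 0 1)ᶜ = 0 →
      Integrable (fun v => k * v + l) μ := fun μ _ hμ =>
    integrable_of_continuous_of_compl_Icc hμ (by fun_prop)
  have hvi : ∀ (μ : Measure ℝ) [IsProbabilityMeasure μ], μ (Icc 0 1)ᶜ = 0 →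
      Integrable (fun v => v) μ := fun μ _ hμ =>
    integrable_of_continuous_of_compl_Icc hμ continuous_id'
  have hsplit : ∀ (μ : Measure ℝ) [IsProbabilityMeasure μ] [NullSingletonClass μ] (f : ℝ → ℝ),
      Integrable f μ → ∫ v, f v ∂μ
        = ∫ v in Iic c, f v ∂μ + ∫ v in Ioo c e, f v ∂μ + ∫ v in Ioi e, f v ∂μ := by
    intro μ _ _ f hf
    rw [← integral_Ioc_eq_integral_Ioo, ← setIntegral_union (Iic_disjoint_Ioc le_rfl)
      measurableSet_Ioc hf.integrableOn hf.integrableOn, Iic_union_Ioc_eq_Iic hce.le,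
      ← setIntegral_union (Iic_disjoint_Ioi le_rfl) measurableSet_Ioi hf.integrableOn
      hf.integrableOn, Iic_union_Ioi, setIntegral_univ]
  have hresc := restrict_Iic_eq_of_cdf_eq hGFc
  have hrese := restrict_Ioi_eq_of_cdf_eq hGFe
  have hmid : ∫ v in Ioo c e, (k * v + l) ∂G = ∫ v in Ioo c e, (k * v + l) ∂F := by
    have hmean : ∫ v in Ioo c e, v ∂G = ∫ v in Ioo c e, v ∂F := by
      have h1 := hsplit G _ (hvi G h.feasible.concentrated)
      have h2 := hsplit F _ (hvi F hF.concentrated)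
      rw [hresc, hrese] at h1
      linarith [h.feasible.mean_eq]
    have hmass : G.real (Ioo c e) = F.real (Ioo c e) := by
      rw [measureReal_Ioo_eq_cdf_sub G hce.le, measureReal_Ioo_eq_cdf_sub F hce.le,
        hGFc c le_rfl, hGFe e le_rfl]
    have key : ∀ (μ : Measure ℝ) [IsProbabilityMeasure μ], μ (Icc 0 1)ᶜ = 0 →
        ∫ v in Ioo c e, (k * v + l) ∂μ = k * ∫ v in Ioo c e, v ∂μ + μ.real (Ioo c e) * l := by
      intro μ _ hμ
      rw [integral_add ((hvi μ hμ).integrableOn.const_mul k) (integrable_const l).integrableOn,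
        integral_const_mul]
      simp
    rw [key G h.feasible.concentrated, key F hF.concentrated, hmean, hmass]
  have hU1 := hsplit G U (hUi G)
  have hH1 := hsplit F _ hHi
  rw [hU, integral_saleProb hn r G, ← hU, hresc, hrese] at hU1
  rw [integral_cdf_pow F hn] at hH1
  have h1 : ∫ v in Iic c, U v ∂F = ∫ v in Iic c, cdf F v ^ (n - 1) ∂F :=
    setIntegral_congr_fun measurableSet_Iic fun v hv => by
      simp only [hU]
      rw [saleProb_of_lt hn G α ((mem_Iic.1 hv).trans_lt (hy.1.trans hy.2)), hGFc v hv]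
  have h2 : ∫ v in Ioo c e, U v ∂G = ∫ v in Ioo c e, (k * v + l) ∂G := by
    refine setIntegral_congr_ae measurableSet_Ioo ?_
    filter_upwards [Measure.support_mem_ae (μ := G)] with v hvs hv
    exact hline.eq v hv hvs
  have h3 : ∫ v in Ioi e, U v ∂F ≤ ∫ v in Ioi e, cdf F v ^ (n - 1) ∂F := by
    refine setIntegral_mono_on (hUi F).integrableOn hHi.integrableOn measurableSet_Ioi
      fun v hv => ?_
    have hev : e ≤ v := (mem_Ioi.1 hv).le
    rw [hU, saleProb_of_ge hn G α (hre.le.trans hev), hGFe v hev]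
    have := hηe.trans (pow_le_pow_left₀ (cdf_nonneg F e) (monotone_cdf F hev) (n - 1))
    nlinarith [mul_le_mul_of_nonneg_left this hα.1.le]
  have h4 : 0 < ∫ v in Ioo c e, (cdf F v ^ (n - 1) - (k * v + l)) ∂F := by
    refine setIntegral_pos_of_pos measurableSet_Ioo ?_ (fun v hv => sub_pos.2 (hlineH v hv))
      (hHi.sub (hli F hF.concentrated)).integrableOn
    have hlt := hF.cdf_lt_cdf hc hce he
    have hm : 0 < F.real (Ioo c e) := by
      rw [measureReal_Ioo_eq_cdf_sub F hce.le]; linarith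
    exact (ENNReal.toReal_pos_iff.1 hm).1
  rw [integral_sub hHi.integrableOn (hli F hF.concentrated).integrableOn] at h4
  linarith

include hr

theorem cdf_reservation_lt_one : cdf G r < 1 := by
  have := h.feasible.isProbabilityMeasure
  refine lt_of_le_of_ne (cdf_le_one G r) fun hq => ?_
  have hG1 : ∀ v, r ≤ v → cdf G v = 1 := fun v hv =>
    le_antisymm (cdf_le_one G v) (hq ▸ monotone_cdf G hv)
  have hs : 0 < slack F G r := by
    rw [← h.feasible.slack_one hF]
    refine slack_lt_slack_of_lt_cdf hr.2 fun t ht => ?_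
    rw [hG1 t ht.1.le, ← hF.cdf_one]
    exact hF.cdf_lt_cdf (hr.1.le.trans ht.1.le) ht.2 le_rfl
  obtain ⟨c, e, hc, hcr, hre, he, hc0, he0, hpos⟩ :=
    h.feasible.exists_slack_component hF ⟨hr.1.le, hr.2.le⟩ hs
  have hη : visitProb n r G = 1 := by
    have hn0 : (n : ℝ) ≠ 0 := by exact_mod_cast (by omega : n ≠ 0)
    simp [visitProb, measureReal_Iio_eq_cdf, hq, hn0]
  -- without a jump at `r`, the payoff is `G ^ (n - 1)` throughout
  refine (h.isOptimal hn hα).not_slack_of_affine (A := 0) (B := 1) hF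
    (measurable_saleProb r G n α) (abs_saleProb_le_one hn hα r G)
    (upperSemicontinuous_saleProb hn hα r G) (fun _ _ => saleProb_lt_saleProb hn hα r G)
    (m := n - 1) (by omega) hconv hc (hcr.trans hre) he hc0 he0 hpos one_pos fun v _ => ?_
  rcases lt_or_ge v r with hv | hv
  · rw [saleProb_of_lt hn G α hv, zero_add, one_mul]
  · rw [saleProb_of_ge hn G α hv, hη, hG1 v hv, one_pow]
    ring

/-- The constraint is slack at the reservation value: otherwise the equilibrium is full disclosure,
and pooling values just below `r` with values above `r` exploits the jump of the payoff at `r`. -/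
theorem slack_reservation_pos : 0 < slack F G r := by
  have := h.feasible.isProbabilityMeasure
  have hr01 : r ∈ Icc (0 : ℝ) 1 := ⟨hr.1.le, hr.2.le⟩
  refine lt_of_le_of_ne (h.feasible.slack_nonneg hr01) fun hr0 => ?_
  have hzero : ∀ v ∈ Icc (0 : ℝ) 1, slack F G v = 0 := by
    intro v hv
    by_contra hne
    obtain ⟨c, e, hc, hcv, hve, he, hc0, he0, hpos⟩ := h.feasible.exists_slack_component hF hv
      (lt_of_le_of_ne (h.feasible.slack_nonneg hv) (Ne.symm hne))
    exact (hpos r (h.reservation_mem_of_slack hn hα hF hconv hc (hcv.trans hve) he hc0 he0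
      hpos)).ne hr0
  have hGF : ∀ v ∈ Icc (0 : ℝ) 1, cdf G v = cdf F v := fun v hv =>
    h.feasible.cdf_eq_of_slack_eq_zero hF hv (hzero v hv)
  have hsupp : ∀ a b, 0 ≤ a → a < b → b ≤ 1 → ∃ y ∈ G.support, a < y ∧ y < b := by
    intro a b ha hab hb
    refine exists_mem_support_of_cdf_lt G ?_
    rw [hGF a ⟨ha, hab.le.trans hb⟩, hGF b ⟨ha.trans hab.le, hb⟩]
    exact hF.cdf_lt_cdf ha hab hb
  set U := saleProb n α r G with hU
  have hjump : 0 < U r - cdf G r ^ (n - 1) := by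
    rw [hU, saleProb_of_ge hn G α le_rfl]
    have h1 := cdf_pow_lt_visitProb hn r G (h.cdf_reservation_lt_one hn hα hr hF hconv)
    nlinarith [mul_lt_mul_of_pos_left h1 hα.1]
  obtain ⟨z, hzs, hrz, hz1⟩ := hsupp r 1 hr.1.le hr.2 le_rfl
  obtain ⟨x, hxs, hxr', hxr⟩ := hsupp (max 0 (r - (z - r) * (U r - cdf G r ^ (n - 1)))) r
    (le_max_left _ _) (max_lt hr.1 (by nlinarith)) hr.2.le
  have hx1 := (le_max_right _ _).trans_lt hxr'
  have h1 := (h.isOptimal hn hα).le_chord_of_mem_support (measurable_saleProb r G n α)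
    (abs_saleProb_le_one hn hα r G) (upperSemicontinuous_saleProb hn hα r G) hxr hrz hxs hzs
  rw [← hU] at h1
  have h2 : U x ≤ cdf G r ^ (n - 1) := by
    rw [hU, saleProb_of_lt hn G α hxr]
    exact pow_le_pow_left₀ (cdf_nonneg G x) (monotone_cdf G hxr.le) _
  have h3 : U z ≤ 1 := (abs_le.1 (abs_saleProb_le_one hn hα r G z)).2
  have h4 : 0 ≤ U r := by
    have : 0 ≤ cdf G r ^ (n - 1) := pow_nonneg (cdf_nonneg G r) _
    linarith
  nlinarith [mul_le_mul_of_nonneg_left h2 (sub_pos.2 hrz).le,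
    mul_le_mul_of_nonneg_left h3 (sub_pos.2 hxr).le, mul_nonneg (sub_pos.2 hxr).le h4]

/-- The constraint binds outside a single interval around the reservation value. -/
theorem exists_slack_interval : ∃ c e, 0 ≤ c ∧ c < r ∧ r < e ∧ e ≤ 1 ∧
    (∀ w ∈ Ioo c e, 0 < slack F G w) ∧ ∀ v ∈ Icc (0 : ℝ) 1, v ∉ Ioo c e → slack F G v = 0 := by
  obtain ⟨c, e, hc, hcr, hre, he, hc0, he0, hpos⟩ := h.feasible.exists_slack_component hF
    ⟨hr.1.le, hr.2.le⟩ (h.slack_reservation_pos hn hα hr hF hconv)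
  refine ⟨c, e, hc, hcr, hre, he, hpos, fun v hv hvce => ?_⟩
  by_contra hne
  obtain ⟨c', e', hc', hcv', hve', he', hc0', he0', hpos'⟩ :=
    h.feasible.exists_slack_component hF hv
      (lt_of_le_of_ne (h.feasible.slack_nonneg hv) (Ne.symm hne))
  obtain ⟨hcr', hre'⟩ := h.reservation_mem_of_slack hn hα hF hconv hc' (hcv'.trans hve') he' hc0'
    he0' hpos'
  rcases le_or_gt v c with hvc | hvc
  · exact (hpos' c ⟨hcv'.trans_le hvc, hcr.trans hre'⟩).ne' hc0
  · have hev : e ≤ v := by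
      by_contra! hlt
      exact hvce ⟨hvc, hlt⟩
    exact (hpos' e ⟨hcr'.trans hre, hev.trans_lt hve'⟩).ne' he0

end

end IsSymmetricEquilibrium

/-! ### The shape of the equilibrium -/

theorem proposition1 (n : ℕ) (hn : 2 ≤ n) (α : ℝ) (hα : α ∈ Ioo (0 : ℝ) 1)
    (r : ℝ) (hr : r ∈ Ioo (0 : ℝ) 1)
    (F : Measure ℝ) (hF : IsPrior F)
    (hconv : ConvexOn ℝ (Icc (0 : ℝ) 1) (fun v => cdf F v ^ (n - 1)))
    (G : Measure ℝ) (hG : IsSymmetricEquilibrium n α r F G) :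
    ∃ β vL vH : ℝ, 0 < β ∧ vL ∈ Ico 0 r ∧ vH ∈ Ioc r 1 ∧
      IsMPC F G ∧
      cdf G vH = cdf F vH ∧
      ∀ v ∈ Icc (0 : ℝ) 1, cdf G v = disclosureCDF n r F β vL vH v := by
  have := hG.feasible.isProbabilityMeasure
  have := hG.nullSingletonClass hn hα hF
  have hGc := continuous_cdf_of_noAtoms G
  have hα1 := sub_pos.2 hα.2
  have husc := upperSemicontinuous_saleProb hn hα r G
  obtain ⟨c, e, hc, hcr, hre, he, hpos, hzero⟩ := hG.exists_slack_interval hn hα hr hF hconv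
  have hGF : ∀ v ∈ Icc (0 : ℝ) 1, v ∉ Ioo c e → cdf G v = cdf F v := fun v hv hvn =>
    hG.feasible.cdf_eq_of_slack_eq_zero hF hv (hzero v hv hvn)
  have hGFc : cdf G c = cdf F c :=
    hGF c ⟨hc, by linarith [hr.2]⟩ fun hm => lt_irrefl _ hm.1
  have hGFe : cdf G e = cdf F e :=
    hGF e ⟨by linarith [hr.1], he⟩ fun hm => lt_irrefl _ hm.2
  have hcelt : cdf G c < cdf G e := by
    rw [hGFc, hGFe]; exact hF.cdf_lt_cdf hc (hcr.trans hre) he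
  obtain ⟨k, l, hline⟩ := (hG.isOptimal hn hα).exists_isSupportLine (measurable_saleProb r G n α)
    (abs_saleProb_le_one hn hα r G) husc (fun _ _ => saleProb_lt_saleProb hn hα r G) hc he hpos
    hcelt
  have hgap : ∀ y ∈ Ioo c r, y ∉ G.support := fun y hy =>
    hG.notMem_support_of_mem_Ioo hn hα hF hconv hc hre he hpos hzero hline hy
  set U := saleProb n α r G with hU
  have hUge : ∀ v, r ≤ v → U v = α * visitProb n r G + (1 - α) * cdf G v ^ (n - 1) :=
    fun v hv => saleProb_of_ge hn G α hv
  have hflat : ∀ v ∈ Icc c r, cdf G v = cdf F c := by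
    intro v hv
    rw [← hGFc]
    refine le_antisymm ?_ (monotone_cdf G hv.1)
    by_contra! hlt
    obtain ⟨y, hys, hcy, hyv⟩ := exists_mem_support_of_cdf_lt G hlt
    exact hgap y ⟨hcy, hyv.trans_le hv.2⟩ hys
  have hGr : cdf G r = cdf F c := hflat r ⟨hcr.le, le_rfl⟩
  have hdown : ∀ v z, r ≤ v → v ≤ z → z < e → z ∈ G.support → v ∈ G.support :=
    fun v z hrv hvz hze hzs =>
      hline.mem_support_of_le (hcr.trans_le hrv) hvz hze hzs fun w hw hwG => by
        rw [hUge w (hrv.trans hw.1), hUge v hrv, hwG]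
  obtain ⟨s, hss, hrs, hse⟩ := exists_mem_support_of_cdf_lt G
    (show cdf G r < cdf G e by rwa [hGr, ← hGFc])
  have hrsupp : r ∈ G.support := hdown r s le_rfl hrs.le hse hss
  have hUr := hline.eq r ⟨hcr, hre⟩ hrsupp
  set β := k / (1 - α) with hβ
  have hβk : (1 - α) * β = k := mul_div_cancel₀ _ hα1.ne'
  -- along the support line, `G ^ (n - 1)` has slope `β`
  have hslope : ∀ v, r ≤ v → k * v + l - U v
      = (1 - α) * (cdf F c ^ (n - 1) + β * (v - r) - cdf G v ^ (n - 1)) := by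
    intro v hv
    have h1 := hUge r le_rfl
    rw [hGr] at h1
    rw [hUge v hv]
    linear_combination h1 - hUr - (v - r) * hβk
  have hmain : EqOn (fun v => cdf G v ^ (n - 1))
      (fun v => min (cdf F c ^ (n - 1) + β * (v - r)) 1) (Icc r e) := by
    have hIco : EqOn (fun v => cdf G v ^ (n - 1))
        (fun v => min (cdf F c ^ (n - 1) + β * (v - r)) 1) (Ico r e) := by
      intro v hv
      have hle := hline.le v ⟨hcr.trans_le hv.1, hv.2⟩
      have hsl := hslope v hv.1
      have hg1 : cdf G v ^ (n - 1) ≤ 1 := pow_le_one₀ (cdf_nonneg G v) (cdf_le_one G v)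
      have hge : cdf G v ^ (n - 1) ≤ cdf F c ^ (n - 1) + β * (v - r) := by
        have : 0 ≤ cdf F c ^ (n - 1) + β * (v - r) - cdf G v ^ (n - 1) :=
          nonneg_of_mul_nonneg_right (by linarith) hα1
        linarith
      refine le_antisymm (le_min hge hg1) ?_
      by_cases hz : ∃ z ∈ G.support, v < z ∧ z < e
      · obtain ⟨z, hzs, hvz, hze⟩ := hz
        have heq := hline.eq v ⟨hcr.trans_le hv.1, hv.2⟩ (hdown v z hv.1 hvz.le hze hzs)
        rw [← heq, sub_self] at hsl
        have := (mul_eq_zero.1 hsl.symm).resolve_left hα1.ne'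
        exact (min_le_left _ _).trans (by linarith)
      · have hGve : cdf G v = cdf G e := by
          refine le_antisymm (monotone_cdf G hv.2.le) ?_
          by_contra! hlt
          obtain ⟨y, hys, h1, h2⟩ := exists_mem_support_of_cdf_lt G hlt
          exact hz ⟨y, hys, h1, h2⟩
        rcases eq_or_lt_of_le he with rfl | he1
        · rw [hGFe, hF.cdf_one] at hGve
          refine (min_le_right _ _).trans ?_
          simp [hGve]
        · -- above `e < 1` there is full disclosure, so `e` is a support point; pooling around `s`
          -- is profitable, because the payoff at `e` lies below the support line
          exfalso
          have hes : e ∈ G.support := by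
            rw [← G.isClosed_support.closure_eq, Metric.mem_closure_iff]
            intro δ hδ
            have hlt : e < min 1 (e + δ) := lt_min he1 (by linarith)
            obtain ⟨y, hys, h1, h2⟩ := exists_mem_support_of_cdf_lt G
              (show cdf G e < cdf G (min 1 (e + δ)) by
                rw [hGFe, hGF _ ⟨by linarith [hr.1], min_le_left _ _⟩
                  fun hm => lt_asymm hm.2 hlt]
                exact hF.cdf_lt_cdf (by linarith [hr.1]) hlt (min_le_left _ _))
            refine ⟨y, hys, ?_⟩
            rw [dist_comm, Real.dist_eq, abs_of_pos (by linarith)]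
            linarith [h2.trans_le (min_le_right _ _)]
          have hUe : U e < k * e + l := by
            have : U e = U v := by rw [hUge e hre.le, hUge v hv.1, hGve]
            have := mul_lt_mul_of_pos_left hv.2 hline.slope_pos
            linarith
          have hpool := (hG.isOptimal hn hα).le_chord_of_mem_support
            (measurable_saleProb r G n α) (abs_saleProb_le_one hn hα r G) husc hrs hse hrsupp hes
          rw [← hU, hUr, hline.eq s ⟨hcr.trans hrs, hse⟩ hss] at hpool
          have := mul_lt_mul_of_pos_left hUe (sub_pos.2 hrs)
          nlinarith
    have := hIco.of_subset_closure (t := Icc r e) (by fun_prop) (by fun_prop) Ico_subset_Icc_self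
      (by rw [closure_Ico hre.ne])
    exact this
  refine ⟨β, c, e, div_pos hline.slope_pos hα1, ⟨hc, hcr⟩, ⟨hre, he⟩, hG.feasible, hGFe,
    fun v hv => ?_⟩
  unfold disclosureCDF
  split_ifs with h1 h2 h3
  · exact hGF v hv fun hm => absurd hm.1 (not_lt.2 h1)
  · exact hflat v ⟨(not_le.1 h1).le, h2.le⟩
  · have hn1 : ((n - 1 : ℕ) : ℝ) = (n : ℝ) - 1 := by
      rw [Nat.cast_sub (by omega), Nat.cast_one]
    have hv' : cdf G v ^ (n - 1) = min (cdf F c ^ (n - 1) + β * (v - r)) 1 :=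
      hmain ⟨not_lt.1 h2, h3⟩
    rw [← hv', ← hn1, one_div,
      Real.pow_rpow_inv_natCast (cdf_nonneg G v) (by omega)]
  · exact hGF v hv fun hm => absurd hm.2.le h3
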